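/- Let $\mathbb O=\mathbb R^8$ with coordinates $x^1,\dots,x^8$, let $\Phi$ be the Cayley 4-form $$\Phi= dx^{5678}-dx^{5128}-dx^{5348}-dx^{6138}-dx^{6428}-dx^{7148}-dx^{7238}+dx^{1234}-dx^{3467}-dx^{1267}-dx^{2457}+dx^{1357}-dx^{2356}-dx^{1456},$$ whose stabilizer is $\mathrm{Spin}(7)\subset SO(8)$, and let $\psi_1,\dots,\psi_7$ be the 4-forms that are the imaginary components of the quadruple cross product of which $\Phi$ is the real part: $$\begin{aligned} \psi_1&=dx^{5134}+dx^{5864}+dx^{7123}+dx^{6421}+dx^{1675}+dx^{7538}+dx^{2786}+dx^{4283},\\ \psi_2&=dx^{3612}+dx^{2354}+dx^{4578}+dx^{7214}+dx^{5863}+dx^{3418}+dx^{5762}+dx^{1876},\\ \psi_3&=dx^{7314}+dx^{4821}+dx^{8476}+dx^{6342}+dx^{3756}+dx^{1253}+dx^{1578}+dx^{8256},\\ \psi_4&=dx^{1364}+dx^{6574}+dx^{4521}+dx^{3812}+dx^{2587}+dx^{6518}+dx^{7234}+dx^{6783},\\ \psi_5&=dx^{7352}+dx^{2847}+dx^{6814}+dx^{8632}+dx^{3817}+dx^{1653}+dx^{4571}+dx^{4265},\\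 \psi_6&=dx^{5346}+dx^{6521}+dx^{5328}+dx^{4387}+dx^{1647}+dx^{7128}+dx^{2763}+dx^{4158},\\ \psi_7&=dx^{8463}+dx^{8531}+dx^{6274}+dx^{6137}+dx^{2485}+dx^{3574}+dx^{7521}+dx^{1628}. \end{aligned}$$ A $\mathrm{Spin}(7)$-adapted frame is the image of the standard basis under an element of $\mathrm{Spin}(7)$. For a smooth family $(e_1,\dots,e_8)$ of such frames put $\omega_{ij}=\langle e_i,de_j\rangle$ and $$\zeta_3=\omega_{31}+i\omega_{41},\ \zeta_6=\omega_{61}-i\omega_{71},\ \zeta_5=\omega_{51}-i\omega_{81},\ \zeta_4=\omega_{32}+i\omega_{42},\ \zeta_7=\omega_{62}-i\omega_{72},\ \zeta_8=\omega_{52}-i\omega_{82}.$$ The forms $\zeta_i$ span the $(1,0)$-forms of a $\mathrm{Spin}(7)$-invariant almost complex structure on the Grassmannian $G(2,\mathbb O)$ of oriented 2-planes $e_1\wedge e_2$. Let $\Sigma$ be a Riemann surface, $\gamma:\Sigma\to G(2,\mathbb O)$ a pseudoholomorphic curve (a smooth map that pulls $(1,0)$-forms back to $(1,0)$-forms), and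 let $U\subset\Sigma$ be open with a smooth $\mathrm{Spin}(7)$-adapted framing $(e_1,\dots,e_8)$ over $U$ such that $\gamma=e_1\wedge e_2$. Assume that the asymptotic cone is nowhere flat over $U$: for no nonempty open $V\subset U$ are the planes $\gamma(\sigma)$, $\sigma\in V$, all contained in one linear subspace of dimension at most $4$. For a smooth section $s$ over $U$ of the bundle $\mathcal H$ with fibre $\gamma(\sigma)^\perp$, let $$\mathbf x:\mathbb R^2\times U\to\mathbb O,\qquad \mathbf x(r_1,r_2,\sigma)=s(\sigma)+r_1e_1(\sigma)+r_2e_2(\sigma),$$ and call $\mathbf x$ Cayley if $\mathbf x^*\psi_m=0$ for $m=1,\dots,7$. With $s=\sum_{a=3}^8 s^ae_a$ and $s'^a=ds^a+\sum_{b=3}^8\omega_{ab}s^b$ put $$a_1=s^3+is^4,\quad a_2=s^6-is^7,\quad a_3=s^5-is^8,\qquad \alpha_1=s'^3+is'^4,\quad \alpha_2=s'^6-is'^7,\quad \alpha_3=s'^5-is'^8 .$$ Put $\theta_1=\zeta_3+i\zeta_4$, $\theta_3=\zeta_6+i\zeta_7$, $\theta_5=\zeta_5+i\zeta_8$, $$[\bar\theta_{od}]=\begin{pmatrix}0&\bar\theta_5&-\bar\theta_3\\-\bar\theta_5&0&\bar\theta_1\\\bar\theta_3&-\bar\theta_1&0\end{pmatrix},$$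 $$\kappa=\begin{pmatrix} i\omega_{43} & -(\omega_{63}+i\omega_{64})-\frac{i}{2}\bar{\theta}_5 & -(\omega_{53}+i\omega_{54})+\frac{i}{2}\bar{\theta}_3\\ (\omega_{63}-i\omega_{64})-\frac{i}{2}{\theta}_5&-i\omega_{76}& (\omega_{65}-i\omega_{75})-\frac{i}{2}\bar{\theta}_1\\ (\omega_{53}-i\omega_{54})+\frac{i}{2}{\theta}_3 & -(\omega_{65}+i\omega_{75})-\frac{i}{2}{\theta}_1&i(\omega_{76}-\omega_{43}-\omega_{21}) \end{pmatrix}.$$ Then: 1. $\alpha_i=da_i+\sum_j\kappa_{ij}a_j+\frac i2\sum_j[\bar\theta_{od}]_{ij}\bar a_j$ for $i=1,2,3$. 2. $\mathbf x$ is Cayley if and only if $\psi_m(e_1,e_2,ds,ds)=0$ and $\psi_m(e_1,e_2,de_k,ds)=0$ for $k=1,2$ and all $m$ (equations between 2-forms on $U$). 3. $\mathbf x$ is Cayley if and only if $\alpha_1,\alpha_2,\alpha_3$ are of type $(1,0)$. 4. The set of the sections $s$ for which $\mathbf x$ is Cayley is the kernel of the first-order $\mathbb R$-linear operator $$s\longmapsto\Bigl(\bar\partial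 a_i+\sum_j\pi^{(0,1)}(\kappa_{ij})\,a_j+\tfrac i2\sum_j[\bar\theta_{od}]_{ij}\,\bar a_j\Bigr)_{i=1,2,3},$$ where $\pi^{(0,1)}$ is the projection to forms of type $(0,1)$. -/

import Mathlib

open scoped Manifold ContDiff InnerProductSpace

namespace Cayley

noncomputable section

/-- The octonions as a Euclidean space `ℝ⁸` with coordinates `x¹, …, x⁸`.  The labels `1, …, 8` are
read in `Fin 8`, so the label `8` is the element `0` of `Fin 8`. -/
abbrev Oct : Type := EuclideanSpace ℝ (Fin 8)

/-- The standard basis vector `e⁰ᵢ = ∂/∂xⁱ`. -/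
def stdVec (i : Fin 8) : Oct := EuclideanSpace.single i (1 : ℝ)

/-- The 4-form `dxⁱ ∧ dxʲ ∧ dxᵏ ∧ dxˡ`. -/
def dx (i j k l : Fin 8) (x y z w : Oct) : ℝ :=
  Matrix.det !![x i, y i, z i, w i; x j, y j, z j, w j; x k, y k, z k, w k; x l, y l, z l, w l]

/-- The Cayley 4-form, the real part of the quadruple cross product. -/
def Phi (x y z w : Oct) : ℝ :=
  dx 5 6 7 8 x y z w - dx 5 1 2 8 x y z w - dx 5 3 4 8 x y z w - dx 6 1 3 8 x y z w
  - dx 6 4 2 8 x y z w - dx 7 1 4 8 x y z w - dx 7 2 3 8 x y z w + dx 1 2 3 4 x y z w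
  - dx 3 4 6 7 x y z w - dx 1 2 6 7 x y z w - dx 2 4 5 7 x y z w + dx 1 3 5 7 x y z w
  - dx 2 3 5 6 x y z w - dx 1 4 5 6 x y z w

/-- The 4-forms `ψ₁, …, ψ₇`, the imaginary components of the quadruple cross product;
`psi m` is `ψ_{m+1}` for `m = 0, …, 6`. -/
def psi (m : Fin 7) (x y z w : Oct) : ℝ :=
  ![dx 5 1 3 4 x y z w + dx 5 8 6 4 x y z w + dx 7 1 2 3 x y z w + dx 6 4 2 1 x y z w
      + dx 1 6 7 5 x y z w + dx 7 5 3 8 x y z w + dx 2 7 8 6 x y z w + dx 4 2 8 3 x y z w,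
    dx 3 6 1 2 x y z w + dx 2 3 5 4 x y z w + dx 4 5 7 8 x y z w + dx 7 2 1 4 x y z w
      + dx 5 8 6 3 x y z w + dx 3 4 1 8 x y z w + dx 5 7 6 2 x y z w + dx 1 8 7 6 x y z w,
    dx 7 3 1 4 x y z w + dx 4 8 2 1 x y z w + dx 8 4 7 6 x y z w + dx 6 3 4 2 x y z w
      + dx 3 7 5 6 x y z w + dx 1 2 5 3 x y z w + dx 1 5 7 8 x y z w + dx 8 2 5 6 x y z w,
    dx 1 3 6 4 x y z w + dx 6 5 7 4 x y z w + dx 4 5 2 1 x y z w + dx 3 8 1 2 x y z w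
      + dx 2 5 8 7 x y z w + dx 6 5 1 8 x y z w + dx 7 2 3 4 x y z w + dx 6 7 8 3 x y z w,
    dx 7 3 5 2 x y z w + dx 2 8 4 7 x y z w + dx 6 8 1 4 x y z w + dx 8 6 3 2 x y z w
      + dx 3 8 1 7 x y z w + dx 1 6 5 3 x y z w + dx 4 5 7 1 x y z w + dx 4 2 6 5 x y z w,
    dx 5 3 4 6 x y z w + dx 6 5 2 1 x y z w + dx 5 3 2 8 x y z w + dx 4 3 8 7 x y z w
      + dx 1 6 4 7 x y z w + dx 7 1 2 8 x y z w + dx 2 7 6 3 x y z w + dx 4 1 5 8 x y z w,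
    dx 8 4 6 3 x y z w + dx 8 5 3 1 x y z w + dx 6 2 7 4 x y z w + dx 6 1 3 7 x y z w
      + dx 2 4 8 5 x y z w + dx 3 5 7 4 x y z w + dx 7 5 2 1 x y z w + dx 1 6 2 8 x y z w] m

/-- A `Spin(7)`-adapted frame `(F₁, …, F₈)`: the image of the standard basis under an element of
`Spin(7)`, the stabilizer of `Φ` in the orthogonal group. -/
def IsAdaptedFrame (F : Fin 8 → Oct) : Prop :=
  Orthonormal ℝ F ∧
    ∀ i j k l, Phi (F i) (F j) (F k) (F l) = Phi (stdVec i) (stdVec j) (stdVec k) (stdVec l)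

/-- The bivector `u ∧ v`, as the skew endomorphism `w ↦ ⟨v, w⟩ u - ⟨u, w⟩ v`. -/
def wedge (u v : Oct) : Oct →L[ℝ] Oct :=
  (innerSL ℝ v).smulRight u - (innerSL ℝ u).smulRight v

/-- The Grassmannian `G(2, 𝕆)` of oriented 2-planes, as the set of the bivectors `u ∧ v` of
oriented orthonormal pairs. -/
def Gr : Set (Oct →L[ℝ] Oct) :=
  {B | ∃ u v : Oct, ‖u‖ = 1 ∧ ‖v‖ = 1 ∧ ⟪u, v⟫_ℝ = 0 ∧ B = wedge u v}

/-- The 2-plane `E` underlying a point of `G(2, 𝕆)`. -/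
def plane (B : Oct →L[ℝ] Oct) : Submodule ℝ Oct := LinearMap.range (B : Oct →ₗ[ℝ] Oct)

/-! ### Forms on a Riemann surface -/

section Surface

variable {S : Type*} [TopologicalSpace S] [ChartedSpace ℂ S]

/-- The real tangent space at `p` of a Riemann surface. -/
abbrev Tan (p : S) : Type := TangentSpace 𝓘(ℝ, ℂ) p

/-- The complex structure of the tangent space: multiplication by `i` in the chart at `p`. -/
def rot (p : S) : Tan p →L[ℝ] Tan p :=
  (Complex.I • ContinuousLinearMap.id ℝ ℂ : ℂ →L[ℝ] ℂ)

/-- A complex-valued covector is of type `(1,0)` if it is complex linear. -/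
def IsOneZero {p : S} (b : Tan p →L[ℝ] ℂ) : Prop :=
  ∀ v, b (rot p v) = Complex.I * b v

/-- The projection `π^{(0,1)}` of complex covectors to their part of type `(0,1)`. -/
def piZeroOne {p : S} (b : Tan p →L[ℝ] ℂ) : Tan p →L[ℝ] ℂ :=
  (1 / 2 : ℂ) • (b + Complex.I • b.comp (rot p))

/-- A real covector as a complex one. -/
def toC {p : S} (b : Tan p →L[ℝ] ℝ) : Tan p →L[ℝ] ℂ := Complex.ofRealCLM.comp b

/-- The complex conjugate of a covector. -/
def bar {p : S} (b : Tan p →L[ℝ] ℂ) : Tan p →L[ℝ] ℂ :=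
  (Complex.conjCLE : ℂ →L[ℝ] ℂ).comp b

/-- The differential at `p` of a function with values in a real normed space. -/
def diff {W : Type*} [NormedAddCommGroup W] [NormedSpace ℝ W] (f : S → W) (p : S) :
    Tan p →L[ℝ] W :=
  mfderiv 𝓘(ℝ, ℂ) 𝓘(ℝ, W) f p

/-! ### Pseudoholomorphic curves in the Grassmannian -/

/-- For a frame `F` with `F₁ ∧ F₂ = γ(p)`, the pull-back to `p` of `ω_{j1}` on the Grassmannian:
`dγ = ∑_{j ≥ 3} (ω_{j1} F_j ∧ F₂ + ω_{j2} F₁ ∧ F_j)`, so `ω_{j1} = ⟨F_j, dγ(F₂)⟩`. -/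
def grOne (γ : S → Oct →L[ℝ] Oct) (F : Fin 8 → Oct) (j : Fin 8) (p : S) : Tan p →L[ℝ] ℝ :=
  (innerSL ℝ (F j)).comp ((ContinuousLinearMap.apply ℝ Oct (F 2)).comp (diff γ p))

/-- The pull-back of `ω_{j2} = -⟨F_j, dγ(F₁)⟩`. -/
def grTwo (γ : S → Oct →L[ℝ] Oct) (F : Fin 8 → Oct) (j : Fin 8) (p : S) : Tan p →L[ℝ] ℝ :=
  -((innerSL ℝ (F j)).comp ((ContinuousLinearMap.apply ℝ Oct (F 1)).comp (diff γ p)))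

/-- A smooth map `γ` from a Riemann surface to `G(2, 𝕆)` is a pseudoholomorphic curve if it pulls
back the `(1,0)`-forms of the `Spin(7)`-invariant almost complex structure to `(1,0)`-forms.  In any
adapted frame `F` with `F₁ ∧ F₂ = γ(p)`, these are spanned by
`ζ₃ = ω₃₁ + i ω₄₁`, `ζ₆ = ω₆₁ - i ω₇₁`, `ζ₅ = ω₅₁ - i ω₈₁`,
`ζ₄ = ω₃₂ + i ω₄₂`, `ζ₇ = ω₆₂ - i ω₇₂`, `ζ₈ = ω₅₂ - i ω₈₂`. -/
def IsPseudoholomorphic (γ : S → Oct →L[ℝ] Oct) : Prop :=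
  ContMDiff 𝓘(ℝ, ℂ) 𝓘(ℝ, Oct →L[ℝ] Oct) ∞ γ ∧ (∀ p, γ p ∈ Gr) ∧
    ∀ (p : S) (F : Fin 8 → Oct), IsAdaptedFrame F → wedge (F 1) (F 2) = γ p →
      IsOneZero (toC (grOne γ F 3 p) + Complex.I • toC (grOne γ F 4 p)) ∧
      IsOneZero (toC (grOne γ F 6 p) - Complex.I • toC (grOne γ F 7 p)) ∧
      IsOneZero (toC (grOne γ F 5 p) - Complex.I • toC (grOne γ F 8 p)) ∧
      IsOneZero (toC (grTwo γ F 3 p) + Complex.I • toC (grTwo γ F 4 p)) ∧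
      IsOneZero (toC (grTwo γ F 6 p) - Complex.I • toC (grTwo γ F 7 p)) ∧
      IsOneZero (toC (grTwo γ F 5 p) - Complex.I • toC (grTwo γ F 8 p))

/-- The planes `γ(p)`, `p ∈ V`, lie in one linear subspace of dimension at most four. -/
def IsFlatOn (γ : S → Oct →L[ℝ] Oct) (V : Set S) : Prop :=
  ∃ P : Submodule ℝ Oct, Module.finrank ℝ P ≤ 4 ∧ ∀ p ∈ V, plane (γ p) ≤ P

/-- A smooth `Spin(7)`-adapted framing `(e₁, …, e₈)` over the open set `U` with `γ = e₁ ∧ e₂`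
(its values off `U` are irrelevant). -/
structure AdaptedFraming (γ : S → Oct →L[ℝ] Oct) (U : TopologicalSpace.Opens S) where
  vec : S → Fin 8 → Oct
  smooth : ∀ i, ContMDiffOn 𝓘(ℝ, ℂ) 𝓘(ℝ, Oct) ∞ (fun p => vec p i) U
  adapted : ∀ p ∈ U, IsAdaptedFrame (vec p)
  span : ∀ p ∈ U, wedge (vec p 1) (vec p 2) = γ p

/-- Smooth sections over `U` of the bundle `γ^* H`, where `H = E^⊥` (values off `U` are
irrelevant). -/
def sectionsH (γ : S → Oct →L[ℝ] Oct) (U : TopologicalSpace.Opens S) : Submodule ℝ (S → Oct) where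
  carrier := {s | ContMDiffOn 𝓘(ℝ, ℂ) 𝓘(ℝ, Oct) ∞ s U ∧ ∀ p ∈ U, s p ∈ (plane (γ p))ᗮ}
  zero_mem' := ⟨contMDiffOn_const, fun _ _ => Submodule.zero_mem _⟩
  add_mem' := fun hs ht =>
    ⟨hs.1.add ht.1, fun p hp => Submodule.add_mem _ (hs.2 p hp) (ht.2 p hp)⟩
  smul_mem' := fun c _ hs =>
    ⟨fun p hp => (contDiff_const_smul c).contMDiff.contMDiffAt.comp_contMDiffWithinAt p (hs.1 p hp),
      fun p hp => Submodule.smul_mem _ c (hs.2 p hp)⟩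

/-! ### The forms of an adapted framing -/

namespace AdaptedFraming

variable {γ : S → Oct →L[ℝ] Oct} {U : TopologicalSpace.Opens S} (e : AdaptedFraming γ U)

/-- The connection forms `ω_{ij} = ⟨e_i, de_j⟩`, so that `de_j = e_i ω_{ij}`. -/
def conn (i j : Fin 8) (p : S) : Tan p →L[ℝ] ℝ :=
  (innerSL ℝ (e.vec p i)).comp (diff (fun q => e.vec q j) p)

/-- `ω_{ij}` as a complex form. -/
def connC (i j : Fin 8) (p : S) : Tan p →L[ℝ] ℂ := toC (e.conn i j p)

def zeta3 (p : S) : Tan p →L[ℝ] ℂ := e.connC 3 1 p + Complex.I • e.connC 4 1 p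
def zeta4 (p : S) : Tan p →L[ℝ] ℂ := e.connC 3 2 p + Complex.I • e.connC 4 2 p
def zeta6 (p : S) : Tan p →L[ℝ] ℂ := e.connC 6 1 p - Complex.I • e.connC 7 1 p
def zeta7 (p : S) : Tan p →L[ℝ] ℂ := e.connC 6 2 p - Complex.I • e.connC 7 2 p
def zeta5 (p : S) : Tan p →L[ℝ] ℂ := e.connC 5 1 p - Complex.I • e.connC 8 1 p
def zeta8 (p : S) : Tan p →L[ℝ] ℂ := e.connC 5 2 p - Complex.I • e.connC 8 2 p

def theta1 (p : S) : Tan p →L[ℝ] ℂ := e.zeta3 p + Complex.I • e.zeta4 p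
def theta3 (p : S) : Tan p →L[ℝ] ℂ := e.zeta6 p + Complex.I • e.zeta7 p
def theta5 (p : S) : Tan p →L[ℝ] ℂ := e.zeta5 p + Complex.I • e.zeta8 p

/-- The matrix `κ` of complex 1-forms. -/
def kappa (p : S) : Matrix (Fin 3) (Fin 3) (Tan p →L[ℝ] ℂ) :=
  !![Complex.I • e.connC 4 3 p,
     -(e.connC 6 3 p + Complex.I • e.connC 6 4 p) - (Complex.I / 2) • bar (e.theta5 p),
     -(e.connC 5 3 p + Complex.I • e.connC 5 4 p) + (Complex.I / 2) • bar (e.theta3 p);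
     (e.connC 6 3 p - Complex.I • e.connC 6 4 p) - (Complex.I / 2) • e.theta5 p,
     -(Complex.I • e.connC 7 6 p),
     (e.connC 6 5 p - Complex.I • e.connC 7 5 p) - (Complex.I / 2) • bar (e.theta1 p);
     (e.connC 5 3 p - Complex.I • e.connC 5 4 p) + (Complex.I / 2) • e.theta3 p,
     -(e.connC 6 5 p + Complex.I • e.connC 7 5 p) - (Complex.I / 2) • e.theta1 p,
     Complex.I • (e.connC 7 6 p - e.connC 4 3 p - e.connC 2 1 p)]

/-- The matrix `[θ̄_od]`, where `θ_od = (θ₁, θ₃, θ₅)` and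
`[v] = (0, v₃, -v₂; -v₃, 0, v₁; v₂, -v₁, 0)`. -/
def bracketThetaBar (p : S) : Matrix (Fin 3) (Fin 3) (Tan p →L[ℝ] ℂ) :=
  !![0, bar (e.theta5 p), -bar (e.theta3 p);
     -bar (e.theta5 p), 0, bar (e.theta1 p);
     bar (e.theta3 p), -bar (e.theta1 p), 0]

/-- The component `s^a = ⟨e_a, s⟩`. -/
def comp (s : S → Oct) (a : Fin 8) (p : S) : ℝ := ⟪e.vec p a, s p⟫_ℝ

/-- `a₁ = s³ + i s⁴`, `a₂ = s⁶ - i s⁷`, `a₃ = s⁵ - i s⁸`. -/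
def coef (s : S → Oct) (i : Fin 3) (p : S) : ℂ :=
  ![(e.comp s 3 p : ℂ) + Complex.I * (e.comp s 4 p : ℂ),
    (e.comp s 6 p : ℂ) - Complex.I * (e.comp s 7 p : ℂ),
    (e.comp s 5 p : ℂ) - Complex.I * (e.comp s 8 p : ℂ)] i

/-- The 1-form `s'^a = ds^a + ∑_{b = 3}^{8} ω_{ab} s^b`, as a complex form. -/
def sPrime (s : S → Oct) (a : Fin 8) (p : S) : Tan p →L[ℝ] ℂ :=
  toC (diff (e.comp s a) p + ∑ b ∈ ({3, 4, 5, 6, 7, 8} : Finset (Fin 8)), e.comp s b p • e.conn a b p)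

/-- `α₁ = s'³ + i s'⁴`, `α₂ = s'⁶ - i s'⁷`, `α₃ = s'⁵ - i s'⁸`. -/
def alpha (s : S → Oct) (i : Fin 3) (p : S) : Tan p →L[ℝ] ℂ :=
  ![e.sPrime s 3 p + Complex.I • e.sPrime s 4 p,
    e.sPrime s 6 p - Complex.I • e.sPrime s 7 p,
    e.sPrime s 5 p - Complex.I • e.sPrime s 8 p] i

/-- The 2-ruled 4-fold `x(r₁, r₂, σ) = r₁ e₁ + r₂ e₂ + s`. -/
def ruled (s : S → Oct) (q : ℝ × ℝ × S) : Oct :=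
  q.1 • e.vec q.2.2 1 + q.2.1 • e.vec q.2.2 2 + s q.2.2

/-- `x : ℝ² × U → 𝕆` is Cayley: `x^* ψ_m = 0` for all `m`.  (Where `x` is not an immersion, the
pull-back of a 4-form to this 4-dimensional domain vanishes, so this says exactly that `x` is a
Cayley 4-fold wherever it is an immersion.) -/
def IsCayley (s : S → Oct) : Prop :=
  ∀ q : ℝ × ℝ × S, q.2.2 ∈ U → ∀ m : Fin 7,
    ∀ v : Fin 4 → TangentSpace (𝓘(ℝ, ℝ).prod (𝓘(ℝ, ℝ).prod 𝓘(ℝ, ℂ))) q,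
      let D : _ →L[ℝ] Oct := mfderiv (𝓘(ℝ, ℝ).prod (𝓘(ℝ, ℝ).prod 𝓘(ℝ, ℂ))) 𝓘(ℝ, Oct) (e.ruled s) q
      psi m (D (v 0)) (D (v 1)) (D (v 2)) (D (v 3)) = 0

/-- The reduced equations `ψ_m(e₁, e₂, ds, ds) = 0`, `ψ_m(e₁, e₂, de_i, ds) = 0` (`i = 1, 2`)
between 2-forms on `U`. -/
def ReducedEquations (s : S → Oct) : Prop :=
  ∀ p ∈ U, ∀ (m : Fin 7) (u v : Tan p),
    psi m (e.vec p 1) (e.vec p 2) (diff s p u) (diff s p v) = 0 ∧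
    ∀ i ∈ ({1, 2} : Finset (Fin 8)),
      psi m (e.vec p 1) (e.vec p 2) (diff (fun q => e.vec q i) p u) (diff s p v)
        - psi m (e.vec p 1) (e.vec p 2) (diff (fun q => e.vec q i) p v) (diff s p u) = 0

theorem contMDiffOn_comp (s : sectionsH γ U) (a : Fin 8) :
    ContMDiffOn 𝓘(ℝ, ℂ) 𝓘(ℝ, ℝ) ∞ (e.comp s.1 a) U := by
  intro p hp
  have h1 := e.smooth a p hp
  have h2 := s.2.1 p hp
  have h3 : ContDiff ℝ ∞ (fun x : Oct × Oct => ⟪x.1, x.2⟫_ℝ) := contDiff_fst.inner ℝ contDiff_snd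
  exact h3.contMDiff.contMDiffAt.comp_contMDiffWithinAt p (h1.prodMk_space h2)

theorem contMDiffOn_coef (s : sectionsH γ U) (i : Fin 3) :
    ContMDiffOn 𝓘(ℝ, ℂ) 𝓘(ℝ, ℂ) ∞ (e.coef s.1 i) U := by
  have key : ∀ (a b : Fin 8) (c : ℂ), ContMDiffOn 𝓘(ℝ, ℂ) 𝓘(ℝ, ℂ) ∞
      (fun p => (e.comp s.1 a p : ℂ) + c * (e.comp s.1 b p : ℂ)) U := by
    intro a b c p hp
    have h3 : ContDiff ℝ ∞ (fun x : ℝ × ℝ => (x.1 : ℂ) + c * (x.2 : ℂ)) :=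
      (Complex.ofRealCLM.contDiff.comp contDiff_fst).add
        (contDiff_const.mul (Complex.ofRealCLM.contDiff.comp contDiff_snd))
    exact h3.contMDiff.contMDiffAt.comp_contMDiffWithinAt p
      ((e.contMDiffOn_comp s a p hp).prodMk_space (e.contMDiffOn_comp s b p hp))
  fin_cases i
  · exact key 3 4 Complex.I
  · refine (key 6 7 (-Complex.I)).congr fun p _ => ?_
    simp [coef, sub_eq_add_neg]
  · refine (key 5 8 (-Complex.I)).congr fun p _ => ?_
    simp [coef, sub_eq_add_neg]

theorem coef_add (s t : S → Oct) (i : Fin 3) : e.coef (s + t) i = e.coef s i + e.coef t i := by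
  funext p
  fin_cases i <;> simp [coef, comp, inner_add_right] <;> ring

theorem coef_smul (c : ℝ) (s : S → Oct) (i : Fin 3) : e.coef (c • s) i = c • e.coef s i := by
  funext p
  fin_cases i <;> simp [coef, comp, inner_smul_right] <;> ring

theorem mdiff_coef (s : sectionsH γ U) (i : Fin 3) {p : S} (hp : p ∈ U) :
    MDifferentiableAt 𝓘(ℝ, ℂ) 𝓘(ℝ, ℂ) (e.coef s.1 i) p :=
  ((e.contMDiffOn_coef s i).contMDiffAt (U.isOpen.mem_nhds hp)).mdifferentiableAt (by simp)

/-- The first-order real-linear operator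
`s ↦ ∂̄a_i + π^{(0,1)}(κ_ij) a_j + (i/2) [θ̄_od]_ij ā_j`
from sections of `H` over `U` to triples of complex 1-forms on `U`. -/
def dbarOperator :
    sectionsH γ U →ₗ[ℝ] ((p : U) → Fin 3 → (Tan (p : S) →L[ℝ] ℂ)) where
  toFun s := fun p i =>
    piZeroOne (diff (e.coef s.1 i) (p : S))
      + ∑ j, e.coef s.1 j p • piZeroOne (e.kappa p i j)
      + (Complex.I / 2) • ∑ j, (starRingEnd ℂ) (e.coef s.1 j p) • e.bracketThetaBar p i j
  map_add' s t := by
    funext p i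
    have h : diff (e.coef s.1 i + e.coef t.1 i) (p : S)
        = diff (e.coef s.1 i) (p : S) + diff (e.coef t.1 i) (p : S) := by
      exact mfderiv_add (e.mdiff_coef s i p.2) (e.mdiff_coef t i p.2)
    ext v
    simp [h, coef_add, piZeroOne, Finset.sum_add_distrib, Fin.sum_univ_three]
    ring
  map_smul' c s := by
    funext p i
    have h : diff (c • e.coef s.1 i) (p : S) = c • diff (e.coef s.1 i) (p : S) := by
      exact const_smul_mfderiv (e.mdiff_coef s i p.2) c
    ext v
    simp [h, coef_smul, piZeroOne, Fin.sum_univ_three]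
    ring

end AdaptedFraming

end Surface

end

end Cayley

/-! The proof has an algebraic half, valid in one frame, and an analytic half, where flatness
enters.

Algebra: the derivation action of `𝔰𝔬(8)` on `Φ` has the span of the `ψ_m` as its image and
`𝔰𝔭𝔦𝔫(7)` as its kernel (a finite table, `lieCoeff_sub_of_lt`). Two facts follow. The span of the
`ψ_m` is invariant under isometries preserving `Φ`, so the forms `ψ_m(e₁, e₂, ·, ·)` of any adapted
frame can be studied in the standard one, where they are the real and imaginary parts of the complex
cross product on `ℂ³`, the normal space (`IsAdaptedFrame.exists_psi_cross`). And the connection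
matrix of a moving adapted frame satisfies seven linear relations, which turn the formula for `α`
into an identity of polynomials (`IsSpin.cplx_sum`).

Write `z_k` for the normal part of `de_k`, `k = 1, 2`, and `A` for that of `ds`; the components of
`A` are the `α_i`. The Cayley condition becomes the vanishing of `Z(u) × Z(v)` for `Z = r₁z₁ + r₂z₂
+ A`. Pseudoholomorphy makes `z_k` complex linear on a complex line, so the terms quadratic in `r`
cancel, and the other coefficients are the reduced equations. If `A` is complex linear as well,
these hold for the same reason.

Conversely, let `B = A(i) - iA(1)`. The reduced equations say `z_k × B = 0` and `A(1) × B = 0`.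
Suppose `B ≠ 0` on an open set, and let `b` be `B` normalised; then `z_k` and `A` take values in
`ℂb`. The antilinear term of the covariant derivative is a cross product with `θ̄`, which is
parallel to `b̄`, so it drops out. Symmetry of the second derivatives of `e_k` gives `c(D_i b - iD_1
b) ∈ ℂb`, where `z_k(1) = cb`; that of `s` gives `f(D_i b - iD_1 b) - N D_1 b ∈ ℂb`, where `A(1) =
fb` and `N = |B|`. Where `c ≠ 0`, `b` is therefore parallel modulo `b`, and the span of `e₁, e₂, b,
ib` is a constant 4-space containing the planes. If all `c` vanish, the plane itself is constant.
Both contradict nowhere flatness (`exists_flat_ball`). -/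

namespace Cayley

/-! ### Derivations of alternating maps -/

/-- The action of an endomorphism on alternating maps as a derivation:
`(A · f)(v₁, …, vₙ) = ∑ f(v₁, …, A vᵢ, …, vₙ)`. -/
def lie {ι M : Type*} [Fintype ι] [hι : DecidableEq ι] [AddCommGroup M] [Module ℝ M] (A : M →ₗ[ℝ] M)
    (f : M [⋀^ι]→ₗ[ℝ] ℝ) : M [⋀^ι]→ₗ[ℝ] ℝ where
  toFun v := ∑ i, f (Function.update v i (A (v i)))
  map_update_add' := by
    intro inst v i x y
    obtain rfl : inst = hι := Subsingleton.elim _ _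
    rw [← Finset.sum_add_distrib]
    refine Finset.sum_congr rfl fun j _ => ?_
    by_cases h : j = i
    · subst h; simp
    · simp only [Function.update_of_ne h]
      rw [Function.update_comm (Ne.symm h), Function.update_comm (Ne.symm h),
        Function.update_comm (Ne.symm h), f.map_update_add]
  map_update_smul' := by
    intro inst v i c x
    obtain rfl : inst = hι := Subsingleton.elim _ _
    rw [Finset.smul_sum]
    refine Finset.sum_congr rfl fun j _ => ?_
    by_cases h : j = i
    · subst h; simp
    · simp only [Function.update_of_ne h]
      rw [Function.update_comm (Ne.symm h), Function.update_comm (Ne.symm h), f.map_update_smul]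
  map_eq_zero_of_eq' := by
    intro v i j hv hij
    -- In every term other than the `i`-th and the `j`-th two equal arguments remain; those two
    -- differ by a transposition and cancel.
    rw [Fintype.sum_eq_add i j hij]
    · have : Function.update v j (A (v j)) = Function.update v i (A (v i)) ∘ Equiv.swap i j := by
        funext k
        rcases eq_or_ne k i with rfl | hi
        · simp [hij, hij.symm, hv]
        · rcases eq_or_ne k j with rfl | hj
          · simp [hv]
          · simp [hi, hj, Equiv.swap_apply_of_ne_of_ne]
      rw [this, f.map_swap _ hij, add_neg_cancel]
    · rintro k ⟨hi, hj⟩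
      exact f.map_eq_zero_of_eq _ (by simp [hi.symm, hj.symm, hv]) hij

theorem lie_apply {ι M : Type*} [Fintype ι] [DecidableEq ι] [AddCommGroup M] [Module ℝ M]
    (A : M →ₗ[ℝ] M) (f : M [⋀^ι]→ₗ[ℝ] ℝ) (v : ι → M) :
    lie A f v = ∑ i, f (Function.update v i (A (v i))) := rfl

/-- Alternating maps that agree on increasing tuples of basis vectors are equal. -/
theorem alternating_ext_strictMono {ι M : Type*} [LinearOrder ι] [AddCommGroup M] [Module ℝ M]
    {n : ℕ} (b : Module.Basis ι ℝ M) {f g : M [⋀^Fin n]→ₗ[ℝ] ℝ}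
    (h : ∀ t : Fin n → ι, StrictMono t → f (fun i => b (t i)) = g (fun i => b (t i))) : f = g := by
  refine Module.Basis.ext_alternating b fun t ht => ?_
  have hs := h (t ∘ Tuple.sort t)
    ((Tuple.monotone_sort t).strictMono_of_injective (ht.comp (Tuple.sort t).injective))
  have hf := f.map_perm (fun i => b (t i)) (Tuple.sort t)
  have hg := g.map_perm (fun i => b (t i)) (Tuple.sort t)
  simp only [Function.comp_def] at hs hf hg
  rw [hf, hg] at hs
  exact MulAction.injective _ hs

/-! ### The forms `Φ` and `ψ_m` as alternating maps -/

noncomputable section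

/-- `dxⁱ ∧ dxʲ ∧ dxᵏ ∧ dxˡ` as an alternating map. -/
def dxAlt (i j k l : Fin 8) : Oct [⋀^Fin 4]→ₗ[ℝ] ℝ :=
  (Matrix.detRowAlternating (n := Fin 4) (R := ℝ)).compLinearMap
    (LinearMap.pi fun r : Fin 4 => (EuclideanSpace.proj (![i, j, k, l] r) : Oct →L[ℝ] ℝ).toLinearMap)

theorem dxAlt_apply (i j k l : Fin 8) (v : Fin 4 → Oct) :
    dxAlt i j k l v = dx i j k l (v 0) (v 1) (v 2) (v 3) := by
  change Matrix.det (Matrix.of fun a b => v a (![i, j, k, l] b)) = _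
  -- The vectors are the rows in `detRowAlternating` and the columns in `dx`.
  rw [← Matrix.det_transpose, dx]
  congr 1
  ext a b
  fin_cases a <;> fin_cases b <;> rfl

/-- The Cayley form as an alternating map. -/
def PhiAlt : Oct [⋀^Fin 4]→ₗ[ℝ] ℝ :=
  dxAlt 5 6 7 8 - dxAlt 5 1 2 8 - dxAlt 5 3 4 8 - dxAlt 6 1 3 8
  - dxAlt 6 4 2 8 - dxAlt 7 1 4 8 - dxAlt 7 2 3 8 + dxAlt 1 2 3 4
  - dxAlt 3 4 6 7 - dxAlt 1 2 6 7 - dxAlt 2 4 5 7 + dxAlt 1 3 5 7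
  - dxAlt 2 3 5 6 - dxAlt 1 4 5 6

theorem PhiAlt_apply (v : Fin 4 → Oct) : PhiAlt v = Phi (v 0) (v 1) (v 2) (v 3) := by
  simp only [PhiAlt, Phi, AlternatingMap.sub_apply, AlternatingMap.add_apply, dxAlt_apply]

/-- The forms `ψ_m` as alternating maps. -/
def psiAlt (m : Fin 7) : Oct [⋀^Fin 4]→ₗ[ℝ] ℝ :=
  ![dxAlt 5 1 3 4 + dxAlt 5 8 6 4 + dxAlt 7 1 2 3 + dxAlt 6 4 2 1
      + dxAlt 1 6 7 5 + dxAlt 7 5 3 8 + dxAlt 2 7 8 6 + dxAlt 4 2 8 3,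
    dxAlt 3 6 1 2 + dxAlt 2 3 5 4 + dxAlt 4 5 7 8 + dxAlt 7 2 1 4
      + dxAlt 5 8 6 3 + dxAlt 3 4 1 8 + dxAlt 5 7 6 2 + dxAlt 1 8 7 6,
    dxAlt 7 3 1 4 + dxAlt 4 8 2 1 + dxAlt 8 4 7 6 + dxAlt 6 3 4 2
      + dxAlt 3 7 5 6 + dxAlt 1 2 5 3 + dxAlt 1 5 7 8 + dxAlt 8 2 5 6,
    dxAlt 1 3 6 4 + dxAlt 6 5 7 4 + dxAlt 4 5 2 1 + dxAlt 3 8 1 2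
      + dxAlt 2 5 8 7 + dxAlt 6 5 1 8 + dxAlt 7 2 3 4 + dxAlt 6 7 8 3,
    dxAlt 7 3 5 2 + dxAlt 2 8 4 7 + dxAlt 6 8 1 4 + dxAlt 8 6 3 2
      + dxAlt 3 8 1 7 + dxAlt 1 6 5 3 + dxAlt 4 5 7 1 + dxAlt 4 2 6 5,
    dxAlt 5 3 4 6 + dxAlt 6 5 2 1 + dxAlt 5 3 2 8 + dxAlt 4 3 8 7
      + dxAlt 1 6 4 7 + dxAlt 7 1 2 8 + dxAlt 2 7 6 3 + dxAlt 4 1 5 8,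
    dxAlt 8 4 6 3 + dxAlt 8 5 3 1 + dxAlt 6 2 7 4 + dxAlt 6 1 3 7
      + dxAlt 2 4 8 5 + dxAlt 3 5 7 4 + dxAlt 7 5 2 1 + dxAlt 1 6 2 8] m

theorem psiAlt_apply (m : Fin 7) (v : Fin 4 → Oct) :
    psiAlt m v = psi m (v 0) (v 1) (v 2) (v 3) := by
  fin_cases m <;> simp [psiAlt, psi, AlternatingMap.add_apply, dxAlt_apply]

end

/-! ### Integer tables of the forms in the standard basis -/

/-- `x` if the labels agree and `0` otherwise. -/
def pick (i a : Fin 8) (x : ℤ) : ℤ := if i = a then x else 0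

def minorTwo (k l c d : Fin 8) : ℤ := pick k c (pick l d 1) - pick k d (pick l c 1)

def minorThree (j k l b c d : Fin 8) : ℤ :=
  pick j b (minorTwo k l c d) - pick j c (minorTwo k l b d) + pick j d (minorTwo k l b c)

/-- The value of `dxⁱʲᵏˡ` on the standard basis vectors with labels `a, b, c, d`. -/
def dxInt (i j k l a b c d : Fin 8) : ℤ :=
  pick i a (minorThree j k l b c d) - pick i b (minorThree j k l a c d)
    + pick i c (minorThree j k l a b d) - pick i d (minorThree j k l a b c)

/-- The components of `Φ` in the standard basis. -/
def phiInt (x y z w : Fin 8) : ℤ :=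
  dxInt 5 6 7 8 x y z w - dxInt 5 1 2 8 x y z w - dxInt 5 3 4 8 x y z w - dxInt 6 1 3 8 x y z w
  - dxInt 6 4 2 8 x y z w - dxInt 7 1 4 8 x y z w - dxInt 7 2 3 8 x y z w + dxInt 1 2 3 4 x y z w
  - dxInt 3 4 6 7 x y z w - dxInt 1 2 6 7 x y z w - dxInt 2 4 5 7 x y z w + dxInt 1 3 5 7 x y z w
  - dxInt 2 3 5 6 x y z w - dxInt 1 4 5 6 x y z w

/-- The components of `ψ_m` in the standard basis. -/
def psiInt (m : Fin 7) (x y z w : Fin 8) : ℤ :=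
  ![dxInt 5 1 3 4 x y z w + dxInt 5 8 6 4 x y z w + dxInt 7 1 2 3 x y z w + dxInt 6 4 2 1 x y z w
      + dxInt 1 6 7 5 x y z w + dxInt 7 5 3 8 x y z w + dxInt 2 7 8 6 x y z w
      + dxInt 4 2 8 3 x y z w,
    dxInt 3 6 1 2 x y z w + dxInt 2 3 5 4 x y z w + dxInt 4 5 7 8 x y z w + dxInt 7 2 1 4 x y z w
      + dxInt 5 8 6 3 x y z w + dxInt 3 4 1 8 x y z w + dxInt 5 7 6 2 x y z w
      + dxInt 1 8 7 6 x y z w,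
    dxInt 7 3 1 4 x y z w + dxInt 4 8 2 1 x y z w + dxInt 8 4 7 6 x y z w + dxInt 6 3 4 2 x y z w
      + dxInt 3 7 5 6 x y z w + dxInt 1 2 5 3 x y z w + dxInt 1 5 7 8 x y z w
      + dxInt 8 2 5 6 x y z w,
    dxInt 1 3 6 4 x y z w + dxInt 6 5 7 4 x y z w + dxInt 4 5 2 1 x y z w + dxInt 3 8 1 2 x y z w
      + dxInt 2 5 8 7 x y z w + dxInt 6 5 1 8 x y z w + dxInt 7 2 3 4 x y z w
      + dxInt 6 7 8 3 x y z w,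
    dxInt 7 3 5 2 x y z w + dxInt 2 8 4 7 x y z w + dxInt 6 8 1 4 x y z w + dxInt 8 6 3 2 x y z w
      + dxInt 3 8 1 7 x y z w + dxInt 1 6 5 3 x y z w + dxInt 4 5 7 1 x y z w
      + dxInt 4 2 6 5 x y z w,
    dxInt 5 3 4 6 x y z w + dxInt 6 5 2 1 x y z w + dxInt 5 3 2 8 x y z w + dxInt 4 3 8 7 x y z w
      + dxInt 1 6 4 7 x y z w + dxInt 7 1 2 8 x y z w + dxInt 2 7 6 3 x y z w
      + dxInt 4 1 5 8 x y z w,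
    dxInt 8 4 6 3 x y z w + dxInt 8 5 3 1 x y z w + dxInt 6 2 7 4 x y z w + dxInt 6 1 3 7 x y z w
      + dxInt 2 4 8 5 x y z w + dxInt 3 5 7 4 x y z w + dxInt 7 5 2 1 x y z w
      + dxInt 1 6 2 8 x y z w] m

/-- Seven elements of `𝔰𝔬(8)` that span the orthogonal complement of `𝔰𝔭𝔦𝔫(7)`. -/
def compl (m : Fin 7) (a b : Fin 8) : ℤ :=
  ![minorTwo 1 8 a b - minorTwo 2 5 a b - minorTwo 3 6 a b - minorTwo 4 7 a b,
    minorTwo 1 5 a b + minorTwo 2 8 a b - minorTwo 3 7 a b + minorTwo 4 6 a b,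
    minorTwo 1 6 a b + minorTwo 2 7 a b + minorTwo 3 8 a b - minorTwo 4 5 a b,
    minorTwo 1 7 a b - minorTwo 2 6 a b + minorTwo 3 5 a b + minorTwo 4 8 a b,
    -minorTwo 1 2 a b - minorTwo 3 4 a b + minorTwo 5 8 a b + minorTwo 6 7 a b,
    -minorTwo 1 3 a b + minorTwo 2 4 a b - minorTwo 5 7 a b + minorTwo 6 8 a b,
    -minorTwo 1 4 a b - minorTwo 2 3 a b + minorTwo 5 6 a b + minorTwo 7 8 a b] m

/-- The coefficient of `A_{ab}` in the component `i, j, k, l` of `A · Φ`. -/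
def lieCoeff (i j k l a b : Fin 8) : ℤ :=
  pick i b (phiInt a j k l) + pick j b (phiInt i a k l) + pick k b (phiInt i j a l)
    + pick l b (phiInt i j k a)

/-- The whole structure of `𝔰𝔬(8) · Φ` in coordinates: the elementary rotation in the `a, b` plane
moves `Φ` by the combination of the `ψ_n` with coefficients `compl n a b`. A finite check; the order
is that of `Fin 8`, in which the label `8` comes first. -/
theorem lieCoeff_sub_of_lt : ∀ i j : Fin 8, i < j → ∀ k, j < k → ∀ l, k < l → ∀ a b, a < b →
    lieCoeff i j k l a b - lieCoeff i j k l b a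
      = compl 0 a b * psiInt 0 i j k l + compl 1 a b * psiInt 1 i j k l
        + compl 2 a b * psiInt 2 i j k l + compl 3 a b * psiInt 3 i j k l
        + compl 4 a b * psiInt 4 i j k l + compl 5 a b * psiInt 5 i j k l
        + compl 6 a b * psiInt 6 i j k l := by
  decide +kernel

theorem compl_swap : ∀ (m : Fin 7) (a b : Fin 8), compl m b a = -compl m a b := by
  decide +kernel

theorem compl_orthogonal : ∀ m n : Fin 7,
    ∑ a, ∑ b, compl m a b * compl n a b = if m = n then 8 else 0 := by
  decide +kernel

theorem lieCoeff_sub {i j k l : Fin 8} (hij : i < j) (hjk : j < k) (hkl : k < l) (a b : Fin 8) :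
    lieCoeff i j k l a b - lieCoeff i j k l b a = ∑ n, compl n a b * psiInt n i j k l := by
  rw [Fin.sum_univ_seven]
  rcases lt_trichotomy a b with h | rfl | h
  · exact lieCoeff_sub_of_lt i j hij k hjk l hkl a b h
  · have h0 : ∀ m, compl m a a = 0 := fun m => by have := compl_swap m a a; omega
    simp [h0]
  · have := lieCoeff_sub_of_lt i j hij k hjk l hkl b a h
    simp only [compl_swap _ b a, neg_mul] at this ⊢
    linarith

theorem stdVec_apply (a i : Fin 8) : stdVec a i = if i = a then 1 else 0 := by
  simp [stdVec]

theorem pick_cast (i a : Fin 8) (x : ℤ) : ((pick i a x : ℤ) : ℝ) = stdVec a i * x := by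
  rw [stdVec_apply, pick]; split_ifs <;> simp

theorem dx_stdVec (i j k l a b c d : Fin 8) :
    dx i j k l (stdVec a) (stdVec b) (stdVec c) (stdVec d) = dxInt i j k l a b c d := by
  simp only [dxInt, minorThree, minorTwo, Int.cast_sub, Int.cast_add, pick_cast, Int.cast_one, dx,
    Matrix.det_succ_row_zero, Fin.sum_univ_succ]
  simp [Fin.succAbove, Matrix.submatrix]
  ring

theorem Phi_stdVec (a b c d : Fin 8) :
    Phi (stdVec a) (stdVec b) (stdVec c) (stdVec d) = phiInt a b c d := by
  simp only [Phi, phiInt, dx_stdVec, Int.cast_sub, Int.cast_add]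

theorem psi_stdVec (m : Fin 7) (a b c d : Fin 8) :
    psi m (stdVec a) (stdVec b) (stdVec c) (stdVec d) = psiInt m a b c d := by
  fin_cases m <;> simp [psi, psiInt, dx_stdVec]

end Cayley

/-! ### Invariance of the span of the `ψ_m`, and the complex cross product -/

namespace Cayley

noncomputable section

/-- The standard basis of `𝕆`. -/
def stdBasis : OrthonormalBasis (Fin 8) ℝ Oct := EuclideanSpace.basisFun (Fin 8) ℝ

theorem stdBasis_apply (i : Fin 8) : stdBasis i = stdVec i := by
  simp [stdBasis, stdVec]

/-- The matrix entry `⟨e⁰ₐ, A e⁰_b⟩`. -/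
def entry (A : Oct →ₗ[ℝ] Oct) (a b : Fin 8) : ℝ := A (stdVec b) a

theorem apply_stdVec (A : Oct →ₗ[ℝ] Oct) (b : Fin 8) :
    A (stdVec b) = ∑ a, entry A a b • stdVec a := by
  ext i
  simp [entry, stdVec_apply]

theorem inner_stdVec (a : Fin 8) (x : Oct) : ⟪stdVec a, x⟫_ℝ = x a := by
  simp [stdVec, EuclideanSpace.inner_single_left]

/-- The component of a matrix along the `m`-th element of the complement of `𝔰𝔭𝔦𝔫(7)`. -/
def complCoeff (m : Fin 7) (w : Fin 8 → Fin 8 → ℝ) : ℝ :=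
  (1 / 2) * ∑ a, ∑ b, (compl m a b : ℝ) * w a b

/-- Paired with a skew `w`, only the skew part of `lieCoeff` counts, and the table gives that part.
The antisymmetrisation is the source of the factor `1/2` in `complCoeff`. -/
theorem sum_lieCoeff {w : Fin 8 → Fin 8 → ℝ} (hw : ∀ a b, w b a = -w a b)
    {i j k l : Fin 8} (hij : i < j) (hjk : j < k) (hkl : k < l) :
    ∑ a, ∑ b, (lieCoeff i j k l a b : ℝ) * w a b
      = ∑ n, complCoeff n w * psiInt n i j k l := by
  have h1 : ∑ a, ∑ b, (lieCoeff i j k l b a : ℝ) * w a b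
      = -∑ a, ∑ b, (lieCoeff i j k l a b : ℝ) * w a b := by
    rw [Finset.sum_comm, ← Finset.sum_neg_distrib]
    refine Finset.sum_congr rfl fun a _ => ?_
    rw [← Finset.sum_neg_distrib]
    refine Finset.sum_congr rfl fun b _ => ?_
    rw [hw a b]; ring
  have h2 : ∑ a, ∑ b, ((lieCoeff i j k l a b : ℝ) - lieCoeff i j k l b a) * w a b
      = 2 * ∑ a, ∑ b, (lieCoeff i j k l a b : ℝ) * w a b := by
    simp only [sub_mul, Finset.sum_sub_distrib]
    rw [h1]; ring
  have h3 : ∀ a b, ((lieCoeff i j k l a b : ℝ) - lieCoeff i j k l b a)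
      = ∑ n, (compl n a b : ℝ) * psiInt n i j k l := fun a b => by
    exact_mod_cast lieCoeff_sub hij hjk hkl a b
  simp only [h3] at h2
  have h4 : ∑ a, ∑ b, (∑ n, (compl n a b : ℝ) * psiInt n i j k l) * w a b
      = 2 * ∑ n, complCoeff n w * psiInt n i j k l := by
    have h5 : ∀ a, ∑ b, (∑ n, (compl n a b : ℝ) * psiInt n i j k l) * w a b
        = ∑ n, ∑ b, (compl n a b : ℝ) * psiInt n i j k l * w a b := fun a => by
      simp only [Finset.sum_mul]
      exact Finset.sum_comm
    simp only [h5]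
    rw [Finset.sum_comm, Finset.mul_sum]
    refine Finset.sum_congr rfl fun n _ => ?_
    simp only [complCoeff, Finset.sum_mul, Finset.mul_sum]
    refine Finset.sum_congr rfl fun a _ => Finset.sum_congr rfl fun b _ => ?_
    ring
  linarith

theorem sum_lieCoeff_eq (w : Fin 8 → Fin 8 → ℝ) (i j k l : Fin 8) :
    ∑ a, ∑ b, (lieCoeff i j k l a b : ℝ) * w a b
      = ∑ a, (w a i * phiInt a j k l + w a j * phiInt i a k l + w a k * phiInt i j a l
          + w a l * phiInt i j k a) := by
  refine Finset.sum_congr rfl fun a _ => ?_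
  simp only [lieCoeff, pick, Int.cast_add, Int.cast_ite, Int.cast_zero, add_mul,
    Finset.sum_add_distrib, ite_mul, zero_mul, Finset.sum_ite_eq, Finset.mem_univ, if_true]
  ring

/-- The infinitesimal action of `𝔰𝔬(8)` on `Φ` has its image in the span of the `ψ_n`. -/
theorem lie_PhiAlt {A : Oct →ₗ[ℝ] Oct} (hA : ∀ a b, entry A b a = -entry A a b) :
    lie A PhiAlt = ∑ n, complCoeff n (entry A) • psiAlt n := by
  refine alternating_ext_strictMono stdBasis.toBasis fun t ht => ?_
  have h := sum_lieCoeff hA (ht (by decide : (0 : Fin 4) < 1)) (ht (by decide : (1 : Fin 4) < 2))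
    (ht (by decide : (2 : Fin 4) < 3))
  rw [sum_lieCoeff_eq] at h
  simp only [OrthonormalBasis.coe_toBasis, stdBasis_apply, Fin.sum_univ_seven, AlternatingMap.add_apply,
    AlternatingMap.smul_apply, psiAlt_apply, psi_stdVec, smul_eq_mul]
  rw [Fin.sum_univ_seven] at h
  rw [← h, lie_apply]
  have h4 : ∀ i, PhiAlt (Function.update (fun i => stdVec (t i)) i (A (stdVec (t i))))
      = ∑ a, entry A a (t i) * PhiAlt (Function.update (fun i => stdVec (t i)) i (stdVec a)) := by
    intro i
    rw [apply_stdVec, AlternatingMap.map_update_sum]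
    simp only [AlternatingMap.map_update_smul, smul_eq_mul]
  simp only [h4, Fin.sum_univ_four, PhiAlt_apply]
  simp only [Finset.sum_add_distrib]
  simp [Phi_stdVec]

/-- The skew endomorphism with matrix `¼ compl m`. -/
def complEnd (m : Fin 7) : Oct →ₗ[ℝ] Oct :=
  stdBasis.toBasis.constr ℝ fun b => ∑ a, ((1 / 4 : ℝ) * compl m a b) • stdVec a

theorem entry_complEnd (m : Fin 7) (a b : Fin 8) :
    entry (complEnd m) a b = (1 / 4 : ℝ) * compl m a b := by
  have : complEnd m (stdVec b) = ∑ a, ((1 / 4 : ℝ) * compl m a b) • stdVec a := by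
    rw [complEnd, ← stdBasis_apply, ← OrthonormalBasis.coe_toBasis, Module.Basis.constr_basis]
  simp [entry, this, stdVec_apply]

/-- Exhibits each `ψ_m` as an infinitesimal rotation of `Φ`, so that symmetries of `Φ` can be
transported to the `ψ_m`. -/
theorem lie_complEnd (m : Fin 7) : lie (complEnd m) PhiAlt = psiAlt m := by
  rw [lie_PhiAlt]
  -- The normalisation `1/4` is chosen here: `1/2 · 1/4 · 8 = 1`, where `8` is the square norm of
  -- `compl m`.
  · have h : ∀ n, complCoeff n (entry (complEnd m)) = if n = m then 1 else 0 := by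
      intro n
      have := compl_orthogonal n m
      have h2 : ∑ a, ∑ b, (compl n a b : ℝ) * compl m a b = if n = m then 8 else 0 := by
        exact_mod_cast this
      have h3 : complCoeff n (entry (complEnd m))
          = (1 / 8) * ∑ a, ∑ b, (compl n a b : ℝ) * compl m a b := by
        simp only [complCoeff, entry_complEnd, Finset.mul_sum]
        refine Finset.sum_congr rfl fun a _ => Finset.sum_congr rfl fun b _ => ?_
        ring
      rw [h3, h2]; split_ifs <;> norm_num
    simp [h]
  · intro a b
    rw [entry_complEnd, entry_complEnd, compl_swap]; push_cast; ring

/-- The span of the `ψ_m` is invariant under the orthogonal transformations that preserve `Φ`. -/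
theorem exists_psiAlt_comp (g : Oct ≃ₗᵢ[ℝ] Oct) (hg : ∀ v, PhiAlt (fun i => g (v i)) = PhiAlt v) :
    ∃ R : Fin 7 → Fin 7 → ℝ, ∀ m v, psiAlt m (fun i => g (v i)) = ∑ n, R m n * psiAlt n v := by
  -- Pulling back by `g` turns `A · Φ` into `(g⁻¹ A g) · g^*Φ`, which is `(g⁻¹ A g) · Φ`. The
  -- conjugate is again skew, so the result is a combination of the `ψ_n`.
  let B : Fin 7 → Oct →ₗ[ℝ] Oct := fun m =>
    g.symm.toLinearEquiv.toLinearMap ∘ₗ complEnd m ∘ₗ g.toLinearEquiv.toLinearMap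
  have hskew : ∀ m (x y : Oct), ⟪complEnd m x, y⟫_ℝ = -⟪x, complEnd m y⟫_ℝ := by
    intro m x y
    have h1 : ∀ x : Oct, x = ∑ a, x a • stdVec a := fun x => by ext i; simp [stdVec_apply]
    have h2 : ∀ a b, ⟪complEnd m (stdVec a), stdVec b⟫_ℝ = -⟪stdVec a, complEnd m (stdVec b)⟫_ℝ := by
      intro a b
      rw [real_inner_comm, inner_stdVec, inner_stdVec]
      have h3 := entry_complEnd m b a
      have h4 := entry_complEnd m a b
      simp only [entry] at h3 h4
      rw [h3, h4, compl_swap]; push_cast; ring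
    rw [h1 x, h1 y]
    simp only [map_sum, map_smul, sum_inner, inner_sum, inner_smul_left, inner_smul_right, h2]
    simp
  refine ⟨fun m n => complCoeff n (entry (B m)), fun m v => ?_⟩
  have hB : lie (B m) PhiAlt = ∑ n, complCoeff n (entry (B m)) • psiAlt n := by
    refine lie_PhiAlt fun a b => ?_
    have hs : ∀ x y : Oct, ⟪x, g.symm y⟫_ℝ = ⟪g x, y⟫_ℝ := fun x y => by
      rw [← g.inner_map_map x (g.symm y), g.apply_symm_apply]
    have h5 : ∀ c d, entry (B m) c d = ⟪g (stdVec c), complEnd m (g (stdVec d))⟫_ℝ := by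
      intro c d
      rw [entry, ← inner_stdVec, ← hs]; rfl
    rw [h5, h5, real_inner_comm, hskew]
  have h6 : lie (B m) PhiAlt v = psiAlt m (fun i => g (v i)) := by
    rw [← lie_complEnd, lie_apply, lie_apply]
    refine Finset.sum_congr rfl fun i _ => ?_
    rw [← hg]
    congr 1
    funext j
    rcases eq_or_ne j i with rfl | h
    · simp [B]
    · simp [h]
  rw [← h6, hB]
  simp [Fin.sum_univ_seven]

/-- The orthogonal transformation that takes the standard basis to an adapted frame. -/
theorem IsAdaptedFrame.exists_isometry {F : Fin 8 → Oct} (hF : IsAdaptedFrame F) :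
    ∃ g : Oct ≃ₗᵢ[ℝ] Oct, (∀ i, g (stdVec i) = F i) ∧
      ∀ v : Fin 4 → Oct, PhiAlt (fun i => g (v i)) = PhiAlt v := by
  obtain ⟨ho, hP⟩ := hF
  let b : OrthonormalBasis (Fin 8) ℝ Oct :=
    (basisOfOrthonormalOfCardEqFinrank ho (by simp)).toOrthonormalBasis (by simpa using ho)
  have hb : ∀ i, b i = F i := by simp [b]
  refine ⟨stdBasis.equiv b (Equiv.refl _), ?_⟩
  have hg : ∀ i, stdBasis.equiv b (Equiv.refl _) (stdVec i) = F i := by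
    intro i
    rw [← stdBasis_apply, OrthonormalBasis.equiv_apply_basis, Equiv.refl_apply, hb]
  refine ⟨hg, fun v => ?_⟩
  have : PhiAlt.compLinearMap (stdBasis.equiv b (Equiv.refl _)).toLinearEquiv.toLinearMap = PhiAlt := by
    refine Module.Basis.ext_alternating stdBasis.toBasis fun t _ => ?_
    simp only [AlternatingMap.compLinearMap_apply, OrthonormalBasis.coe_toBasis, stdBasis_apply]
    rw [PhiAlt_apply, PhiAlt_apply]
    simp only [LinearEquiv.coe_coe, LinearIsometryEquiv.coe_toLinearEquiv, hg]
    exact hP _ _ _ _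
  exact congrArg (fun f => f v) this

/-- The complex coordinates `x³ + i x⁴`, `x⁶ - i x⁷`, `x⁵ - i x⁸` of a vector in a frame. -/
def cplx (x : Fin 8 → ℝ) : Fin 3 → ℂ :=
  ![(x 3 : ℂ) + Complex.I * (x 4 : ℂ), (x 6 : ℂ) - Complex.I * (x 7 : ℂ),
    (x 5 : ℂ) - Complex.I * (x 8 : ℂ)]

/-- The complex coordinates of the part of `X` normal to `F₁ ∧ F₂`. -/
def normalCoord (F : Fin 8 → Oct) (X : Oct) : Fin 3 → ℂ := cplx fun a => ⟪F a, X⟫_ℝ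

/-- The real and imaginary parts of the components of a vector, in the order of the `ψ_m`. -/
def crossToPsi : (Fin 3 → ℂ) →ₗ[ℝ] (Fin 7 → ℝ) where
  toFun c := ![(c 2).im, (c 2).re, (c 1).re, (c 1).im, 0, -(c 0).re, (c 0).im]
  map_add' x y := by ext m; fin_cases m <;> (simp; try ring)
  map_smul' r x := by ext m; fin_cases m <;> simp

/-- A left inverse of `crossToPsi`; it ignores the entry of `ψ₅`, which carries no information. -/
def psiToCross : (Fin 7 → ℝ) →ₗ[ℝ] (Fin 3 → ℂ) where
  toFun p := ![⟨-p 5, p 6⟩, ⟨p 2, p 3⟩, ⟨p 1, p 0⟩]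
  map_add' x y := by ext m; fin_cases m <;> (simp [Complex.ext_iff]; try ring)
  map_smul' r x := by ext m; fin_cases m <;> simp [Complex.ext_iff]

/-- Only the monomials containing both labels `1` and `2` survive. For `m ≠ 5` there are two in
`ψ_m`, and they give the real or imaginary part of a component of the cross product up to sign; `ψ₅`
has none, whence the zero entry. -/
theorem psi_stdVec_one_two (x y : Oct) :
    (fun m => psi m (stdVec 1) (stdVec 2) x y)
      = crossToPsi (crossProduct (cplx x) (cplx y)) := by
  have h : ∀ i j k l : Fin 8, dx i j k l (stdVec 1) (stdVec 2) x y =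
      (stdVec 1 i * stdVec 2 j - stdVec 1 j * stdVec 2 i) * (x k * y l - x l * y k)
      - (stdVec 1 i * stdVec 2 k - stdVec 1 k * stdVec 2 i) * (x j * y l - x l * y j)
      + (stdVec 1 i * stdVec 2 l - stdVec 1 l * stdVec 2 i) * (x j * y k - x k * y j)
      + (stdVec 1 j * stdVec 2 k - stdVec 1 k * stdVec 2 j) * (x i * y l - x l * y i)
      - (stdVec 1 j * stdVec 2 l - stdVec 1 l * stdVec 2 j) * (x i * y k - x k * y i)
      + (stdVec 1 k * stdVec 2 l - stdVec 1 l * stdVec 2 k) * (x i * y j - x j * y i) := by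
    intro i j k l
    simp only [dx, Matrix.det_succ_row_zero, Fin.sum_univ_succ]
    simp [Fin.succAbove, Matrix.submatrix]
    ring
  ext m
  fin_cases m <;> simp [psi, h, stdVec_apply, crossToPsi, cplx, cross_apply, Fin.ext_iff] <;> ring

theorem psiToCross_crossToPsi (c : Fin 3 → ℂ) : psiToCross (crossToPsi c) = c := by
  ext i; fin_cases i <;> simp [psiToCross, crossToPsi]

/-- In an adapted frame the forms `ψ_m(F₁, F₂, ·, ·)` are equivalent to the complex cross product
of the normal coordinates. -/
theorem IsAdaptedFrame.exists_psi_cross {F : Fin 8 → Oct} (hF : IsAdaptedFrame F) :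
    ∃ (T : (Fin 3 → ℂ) →ₗ[ℝ] (Fin 7 → ℝ)) (T' : (Fin 7 → ℝ) →ₗ[ℝ] (Fin 3 → ℂ)), ∀ X Y,
      (fun m => psi m (F 1) (F 2) X Y) = T (crossProduct (normalCoord F X) (normalCoord F Y)) ∧
      crossProduct (normalCoord F X) (normalCoord F Y) = T' (fun m => psi m (F 1) (F 2) X Y) := by
  obtain ⟨g, hgF, hg⟩ := hF.exists_isometry
  obtain ⟨R, hR⟩ := exists_psiAlt_comp g hg
  -- Invariance under the inverse isometry is needed too: the cross product must be recovered from
  -- the `ψ_m` of the frame.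
  obtain ⟨R', hR'⟩ := exists_psiAlt_comp g.symm (fun v => by rw [← hg]; simp)
  refine ⟨Matrix.toLin' (Matrix.of R) ∘ₗ crossToPsi, psiToCross ∘ₗ Matrix.toLin' (Matrix.of R'),
    fun X Y => ?_⟩
  have hc : ∀ X, normalCoord F X = cplx (g.symm X) := by
    intro X
    have : ∀ a, ⟪F a, X⟫_ℝ = g.symm X a := fun a => by
      rw [← inner_stdVec, ← hgF, ← g.inner_map_map (stdVec a), g.apply_symm_apply]
    simp only [normalCoord, this]
  rw [hc, hc]
  have h1 : (fun m => psi m (F 1) (F 2) X Y) = Matrix.toLin' (Matrix.of R)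
      (fun m => psi m (stdVec 1) (stdVec 2) (g.symm X) (g.symm Y)) := by
    ext m
    have := hR m ![stdVec 1, stdVec 2, g.symm X, g.symm Y]
    simp only [psiAlt_apply] at this
    simpa [hgF, Matrix.mulVec, dotProduct] using this
  have h2 : (fun m => psi m (stdVec 1) (stdVec 2) (g.symm X) (g.symm Y))
      = Matrix.toLin' (Matrix.of R') (fun m => psi m (F 1) (F 2) X Y) := by
    ext m
    have := hR' m ![F 1, F 2, X, Y]
    simp only [psiAlt_apply] at this
    simpa [← hgF, Matrix.mulVec, dotProduct] using this
  constructor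
  · rw [h1, psi_stdVec_one_two]; rfl
  · rw [LinearMap.comp_apply, ← h2, psi_stdVec_one_two, psiToCross_crossToPsi]

end

end Cayley

/-! ### Moving adapted frames and the relations of `𝔰𝔭𝔦𝔫(7)` -/

namespace Cayley

open Filter Topology

noncomputable section

theorem continuous_PhiAlt : Continuous fun v : Fin 4 → Oct => PhiAlt v := by
  have h : ∀ i j k l, Continuous fun v : Fin 4 → Oct => dxAlt i j k l v := by
    intro i j k l
    change Continuous fun v : Fin 4 → Oct => Matrix.det (Matrix.of fun a b => v a (![i, j, k, l] b))
    refine Continuous.matrix_det (continuous_matrix fun a b => ?_)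
    exact (EuclideanSpace.proj (𝕜 := ℝ) (![i, j, k, l] b)).continuous.comp (continuous_apply a)
  simp only [PhiAlt, AlternatingMap.sub_apply, AlternatingMap.add_apply]
  fun_prop (disch := assumption)

/-- The Leibniz rule for a continuous alternating map along a curve. -/
theorem hasDerivAt_alternating {f : Oct [⋀^Fin 4]→ₗ[ℝ] ℝ} (hf : Continuous fun v => f v)
    {x : ℝ → Fin 4 → Oct} {x' : Fin 4 → Oct} {t : ℝ}
    (h : ∀ i, HasDerivAt (fun s => x s i) (x' i) t) :
    HasDerivAt (fun s => f (x s)) (∑ i, f (Function.update (x t) i (x' i))) t := by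
  let F : ContinuousMultilinearMap ℝ (fun _ : Fin 4 => Oct) ℝ := ⟨f.toMultilinearMap, hf⟩
  have h2 := (HasFDerivAt.multilinear_comp F (fun i => (h i).hasFDerivAt)).hasDerivAt
  have h3 : ∑ i, f (Function.update (x t) i (x' i))
      = (∑ i, F.toContinuousLinearMap (fun j => x t j) i ∘L
          ContinuousLinearMap.toSpanSingleton ℝ (x' i)) 1 := by
    simp only [sum_apply, ContinuousLinearMap.comp_apply,
      ContinuousLinearMap.toSpanSingleton_apply, one_smul]
    rfl
  rw [h3]
  exact h2

/-- The entries `ω_{ab} = ⟨F_a, F_b'⟩` of the velocity of a moving frame. -/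
def velocity (F F' : Fin 8 → Oct) (a b : Fin 8) : ℝ := ⟪F a, F' b⟫_ℝ

theorem velocity_swap {F : ℝ → Fin 8 → Oct} {F' : Fin 8 → Oct} {t : ℝ}
    (hF : ∀ᶠ s in 𝓝 t, IsAdaptedFrame (F s))
    (hd : ∀ i, HasDerivAt (fun s => F s i) (F' i) t) (a b : Fin 8) :
    velocity (F t) F' b a = -velocity (F t) F' a b := by
  have h1 := (hd a).inner ℝ (hd b)
  have h2 : HasDerivAt (fun s => ⟪F s a, F s b⟫_ℝ) 0 t := by
    refine (hasDerivAt_const t (if a = b then (1 : ℝ) else 0)).congr_of_eventuallyEq ?_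
    filter_upwards [hF] with s hs
    exact orthonormal_iff_ite.1 hs.1 a b
  have := h1.unique h2
  simp only [velocity]
  rw [real_inner_comm (F' a)]
  linarith

theorem IsAdaptedFrame.sum_inner_smul {F : Fin 8 → Oct} (hF : IsAdaptedFrame F) (x : Oct) :
    ∑ a, ⟪F a, x⟫_ℝ • F a = x := by
  let b : OrthonormalBasis (Fin 8) ℝ Oct :=
    (basisOfOrthonormalOfCardEqFinrank hF.1 (by simp)).toOrthonormalBasis (by simpa using hF.1)
  have hb : ∀ i, b i = F i := by simp [b]
  simpa [hb] using b.sum_repr' x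

/-- A component at which `ψ_n` alone is nonzero lets one read off the `n`-th coefficient of a
combination of the `ψ_m`. -/
theorem exists_psiInt_eq : ∀ n : Fin 7, ∃ i j : Fin 8, i < j ∧ ∃ k, j < k ∧ ∃ l, k < l ∧
    psiInt n i j k l ≠ 0 ∧ ∀ m, m ≠ n → psiInt m i j k l = 0 := by
  decide +kernel

/-- The velocity of a moving adapted frame lies in `𝔰𝔭𝔦𝔫(7)`. -/
theorem complCoeff_velocity {F : ℝ → Fin 8 → Oct} {F' : Fin 8 → Oct} {t : ℝ}
    (hF : ∀ᶠ s in 𝓝 t, IsAdaptedFrame (F s))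
    (hd : ∀ i, HasDerivAt (fun s => F s i) (F' i) t) (n : Fin 7) :
    complCoeff n (velocity (F t) F') = 0 := by
  obtain ⟨i, j, hij, k, hjk, l, hkl, hn, hm⟩ := exists_psiInt_eq n
  have h1 := sum_lieCoeff (velocity_swap hF hd) hij hjk hkl
  have hFt := hF.self_of_nhds
  rw [Finset.sum_eq_single n (fun m _ h => by simp [hm m h]) (by simp), sum_lieCoeff_eq] at h1
  -- The components of `Φ` in an adapted frame are constant, so their Leibniz derivative, which is
  -- the component of the velocity matrix acting on `Φ`, is zero.
  have h2 := hasDerivAt_alternating continuous_PhiAlt (x := fun s => ![F s i, F s j, F s k, F s l])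
    (x' := ![F' i, F' j, F' k, F' l]) (t := t) (by intro r; fin_cases r <;> simp [hd])
  have h3 : HasDerivAt (fun s => PhiAlt ![F s i, F s j, F s k, F s l]) 0 t := by
    refine (hasDerivAt_const t (phiInt i j k l : ℝ)).congr_of_eventuallyEq ?_
    filter_upwards [hF] with s hs
    rw [PhiAlt_apply, ← Phi_stdVec]
    exact hs.2 _ _ _ _
  have h4 := h2.unique h3
  have h5 : ∀ (r : Fin 4) (c : Fin 8),
      PhiAlt (Function.update ![F t i, F t j, F t k, F t l] r (F' c))
      = ∑ a, velocity (F t) F' a c * PhiAlt (Function.update ![F t i, F t j, F t k, F t l] r (F t a)) := by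
    intro r c
    nth_rw 1 [← hFt.sum_inner_smul (F' c)]
    rw [AlternatingMap.map_update_sum]
    simp only [AlternatingMap.map_update_smul, smul_eq_mul, velocity]
  have h6 : ∀ a b c d, Phi (F t a) (F t b) (F t c) (F t d) = phiInt a b c d := fun a b c d => by
    rw [hFt.2, Phi_stdVec]
  rw [Fin.sum_univ_four] at h4
  simp only [Matrix.cons_val_zero, Matrix.cons_val_one, Matrix.cons_val, h5, PhiAlt_apply] at h4
  rw [← Finset.sum_add_distrib, ← Finset.sum_add_distrib, ← Finset.sum_add_distrib] at h4
  simp [h6] at h4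
  rw [h4] at h1
  have : (psiInt n i j k l : ℝ) ≠ 0 := by exact_mod_cast hn
  exact (mul_eq_zero.1 h1.symm).resolve_right this

/-- A matrix in `𝔰𝔭𝔦𝔫(7)`. -/
structure IsSpin (w : Fin 8 → Fin 8 → ℝ) : Prop where
  swap : ∀ a b, w b a = -w a b
  complCoeff : ∀ n, complCoeff n w = 0

theorem isSpin_velocity {F : ℝ → Fin 8 → Oct} {F' : Fin 8 → Oct} {t : ℝ}
    (hF : ∀ᶠ s in 𝓝 t, IsAdaptedFrame (F s))
    (hd : ∀ i, HasDerivAt (fun s => F s i) (F' i) t) : IsSpin (velocity (F t) F') :=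
  ⟨velocity_swap hF hd, complCoeff_velocity hF hd⟩

/-- The value of `θ₁`, `θ₃`, `θ₅` on a tangent vector, in terms of the connection matrix. -/
def thetaVec (w : Fin 8 → Fin 8 → ℝ) : Fin 3 → ℂ :=
  cplx (fun a => w a 1) + Complex.I • cplx (fun a => w a 2)

/-- The value of `κ` on a tangent vector, in terms of the connection matrix. -/
def kappaMat (w : Fin 8 → Fin 8 → ℝ) : Matrix (Fin 3) (Fin 3) ℂ :=
  !![Complex.I * w 4 3,
     -(w 6 3 + Complex.I * w 6 4) - (Complex.I / 2) * starRingEnd ℂ (thetaVec w 2),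
     -(w 5 3 + Complex.I * w 5 4) + (Complex.I / 2) * starRingEnd ℂ (thetaVec w 1);
     (w 6 3 - Complex.I * w 6 4) - (Complex.I / 2) * thetaVec w 2,
     -(Complex.I * w 7 6),
     (w 6 5 - Complex.I * w 7 5) - (Complex.I / 2) * starRingEnd ℂ (thetaVec w 0);
     (w 5 3 - Complex.I * w 5 4) + (Complex.I / 2) * thetaVec w 1,
     -(w 6 5 + Complex.I * w 7 5) - (Complex.I / 2) * thetaVec w 0,
     Complex.I * (w 7 6 - w 4 3 - w 2 1)]

/-- The value of `[θ̄_od]` on a tangent vector, in terms of the connection matrix. -/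
def bracketMat (w : Fin 8 → Fin 8 → ℝ) : Matrix (Fin 3) (Fin 3) ℂ :=
  !![0, starRingEnd ℂ (thetaVec w 2), -starRingEnd ℂ (thetaVec w 1);
     -starRingEnd ℂ (thetaVec w 2), 0, starRingEnd ℂ (thetaVec w 0);
     starRingEnd ℂ (thetaVec w 1), -starRingEnd ℂ (thetaVec w 0), 0]

/-- Each element of the complement contains exactly one pair with the label `8`; the corresponding
equation is solved for that entry. -/
theorem IsSpin.relations {w : Fin 8 → Fin 8 → ℝ} (h : IsSpin w) :
    w 8 1 = w 5 2 + w 6 3 + w 7 4 ∧ w 8 2 = -w 5 1 + w 7 3 - w 6 4 ∧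
    w 8 3 = -w 6 1 - w 7 2 + w 5 4 ∧ w 8 4 = -w 7 1 + w 6 2 - w 5 3 ∧
    w 8 5 = w 2 1 + w 4 3 - w 7 6 ∧ w 8 6 = w 3 1 - w 4 2 + w 7 5 ∧
    w 8 7 = w 4 1 + w 3 2 - w 6 5 := by
  have h0 := h.complCoeff 0
  have h1 := h.complCoeff 1
  have h2 := h.complCoeff 2
  have h3 := h.complCoeff 3
  have h4 := h.complCoeff 4
  have h5 := h.complCoeff 5
  have h6 := h.complCoeff 6
  have hs := h.swap
  simp [Cayley.complCoeff, compl, minorTwo, pick, Fin.sum_univ_eight] at h0 h1 h2 h3 h4 h5 h6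
  have s1 := hs 8 1; have s2 := hs 8 2; have s3 := hs 8 3; have s4 := hs 8 4
  have s5 := hs 8 5; have s6 := hs 8 6; have s7 := hs 8 7
  have t1 := hs 5 2; have t2 := hs 6 3; have t3 := hs 7 4; have t4 := hs 5 1; have t5 := hs 7 3
  have t6 := hs 6 4; have t7 := hs 6 1; have t8 := hs 7 2; have t9 := hs 5 4; have t10 := hs 7 1
  have t11 := hs 6 2; have t12 := hs 5 3; have t13 := hs 2 1; have t14 := hs 4 3
  have t15 := hs 7 6; have t16 := hs 3 1; have t17 := hs 4 2; have t18 := hs 7 5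
  have t19 := hs 4 1; have t20 := hs 3 2; have t21 := hs 6 5
  -- `simp` has written some of the labels `8` as `0`; `linarith` needs the same atoms throughout.
  simp only [show (8 : Fin 8) = 0 from rfl] at *
  refine ⟨?_, ?_, ?_, ?_, ?_, ?_, ?_⟩ <;> linarith

/-- The action of `𝔰𝔭𝔦𝔫(7)` on the normal space in complex coordinates. -/
theorem IsSpin.cplx_sum {w : Fin 8 → Fin 8 → ℝ} (h : IsSpin w) (s : Fin 8 → ℝ) (i : Fin 3) :
    cplx (fun a => ∑ b ∈ ({3, 4, 5, 6, 7, 8} : Finset (Fin 8)), s b * w a b) i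
      = ∑ j, cplx s j * kappaMat w i j
        + (Complex.I / 2) * ∑ j, starRingEnd ℂ (cplx s j) * bracketMat w i j := by
  obtain ⟨r1, r2, r3, r4, r5, r6, r7⟩ := h.relations
  have hs := h.swap
  have d : ∀ a, w a a = 0 := fun a => by have := hs a a; linarith
  have hsum : ∀ f : Fin 8 → ℝ, ∑ b ∈ ({3, 4, 5, 6, 7, 8} : Finset (Fin 8)), f b
      = f 3 + f 4 + f 5 + f 6 + f 7 + f 8 := fun f => by
    rw [Finset.sum_insert (by decide), Finset.sum_insert (by decide), Finset.sum_insert (by decide),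
      Finset.sum_insert (by decide), Finset.sum_insert (by decide), Finset.sum_singleton]
    ring
  simp only [hsum]
  have e1 := hs 4 3; have e2 := hs 5 3; have e3 := hs 6 3; have e4 := hs 7 3; have e5 := hs 8 3
  have e6 := hs 5 4; have e7 := hs 6 4; have e8 := hs 7 4; have e9 := hs 8 4; have e10 := hs 6 5
  have e11 := hs 7 5; have e12 := hs 8 5; have e13 := hs 7 6; have e14 := hs 8 6
  have e15 := hs 8 7
  simp only [show (8 : Fin 8) = 0 from rfl] at r1 r2 r3 r4 r5 r6 r7 e5 e9 e12 e14 e15 ⊢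
  -- Once the row of the label `8` is eliminated and skewness is used, the real and imaginary parts
  -- are identities of polynomials in the remaining entries.
  fin_cases i <;>
  · simp [Fin.sum_univ_three, kappaMat, bracketMat, thetaVec, cplx, d, e1, e2, e3, e4, e5, e6, e7,
      e8, e9, e10, e11, e12, e13, e14, e15, r1, r2, r3, r4, r5, r6, r7, Complex.ext_iff]
    constructor <;> ring

end

end Cayley

namespace Cayley

open Filter Topology

noncomputable section

/-! ### The normal coordinates along a moving frame -/

theorem cplx_add (x y : Fin 8 → ℝ) : cplx (fun a => x a + y a) = cplx x + cplx y := by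
  ext i; fin_cases i <;> simp [cplx] <;> ring

theorem cplx_smul (r : ℝ) (x : Fin 8 → ℝ) : cplx (fun a => r * x a) = (r : ℂ) • cplx x := by
  ext i; fin_cases i <;> simp [cplx] <;> ring

theorem hasDerivAt_cplx {x : ℝ → Fin 8 → ℝ} {x' : Fin 8 → ℝ} {t : ℝ}
    (h : ∀ a, HasDerivAt (fun s => x s a) (x' a) t) :
    HasDerivAt (fun s => cplx (x s)) (cplx x') t := by
  refine hasDerivAt_pi.2 fun i => ?_
  fin_cases i
  · exact (h 3).ofReal_comp.add ((h 4).ofReal_comp.const_mul _)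
  · exact (h 6).ofReal_comp.sub ((h 7).ofReal_comp.const_mul _)
  · exact (h 5).ofReal_comp.sub ((h 8).ofReal_comp.const_mul _)

/-- The derivative of the coordinates of a vector in a moving frame. -/
theorem inner_deriv_eq {F : ℝ → Fin 8 → Oct} {F' : Fin 8 → Oct} {X : ℝ → Oct} {X' : Oct} {t : ℝ}
    (hF : ∀ᶠ s in 𝓝 t, IsAdaptedFrame (F s))
    (hd : ∀ i, HasDerivAt (fun s => F s i) (F' i) t) (hX : HasDerivAt X X' t) (a : Fin 8) :
    HasDerivAt (fun s => ⟪F s a, X s⟫_ℝ)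
      (⟪F t a, X'⟫_ℝ - ∑ b, ⟪F t b, X t⟫_ℝ * velocity (F t) F' a b) t := by
  have h1 := (hd a).inner ℝ hX
  have h2 : ⟪F' a, X t⟫_ℝ = -∑ b, ⟪F t b, X t⟫_ℝ * velocity (F t) F' a b := by
    nth_rw 1 [← hF.self_of_nhds.sum_inner_smul (X t)]
    rw [inner_sum, ← Finset.sum_neg_distrib]
    refine Finset.sum_congr rfl fun b _ => ?_
    rw [inner_smul_right, real_inner_comm (F t b) (F' a)]
    change _ * velocity (F t) F' b a = _
    rw [velocity_swap hF hd a b]; ring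
  rw [h2] at h1
  exact h1

/-- The covariant derivative of the normal coordinates in a moving adapted frame. -/
theorem normalCoord_deriv_eq {F : ℝ → Fin 8 → Oct} {F' : Fin 8 → Oct} {X : ℝ → Oct} {X' : Oct}
    {t : ℝ} (hF : ∀ᶠ s in 𝓝 t, IsAdaptedFrame (F s))
    (hd : ∀ i, HasDerivAt (fun s => F s i) (F' i) t) (hX : HasDerivAt X X' t) {Z' : Fin 3 → ℂ}
    (hZ : HasDerivAt (fun s => normalCoord (F s) (X s)) Z' t) :
    normalCoord (F t) X' = Z' + (⟪F t 1, X t⟫_ℝ : ℂ) • normalCoord (F t) (F' 1)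
      + (⟪F t 2, X t⟫_ℝ : ℂ) • normalCoord (F t) (F' 2)
      + (kappaMat (velocity (F t) F')).mulVec (normalCoord (F t) (X t))
      + (Complex.I / 2) • (bracketMat (velocity (F t) F')).mulVec
          (fun j => starRingEnd ℂ (normalCoord (F t) (X t) j)) := by
  set w := velocity (F t) F'
  set x : Fin 8 → ℝ := fun b => ⟪F t b, X t⟫_ℝ with hx
  have h1 := hasDerivAt_cplx fun a => inner_deriv_eq hF hd hX a
  have h2 := hZ.unique h1
  have hw : IsSpin w := isSpin_velocity hF hd
  -- The connection terms subtracted by `inner_deriv_eq` are added back. The labels `1` and `2` give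
  -- the tangential contributions, and the other six give `κ` and the antilinear term.
  have h3 : normalCoord (F t) X' = cplx (fun a => (⟪F t a, X'⟫_ℝ - ∑ b, x b * w a b)
      + (x 1 * w a 1 + (x 2 * w a 2
        + ∑ b ∈ ({3, 4, 5, 6, 7, 8} : Finset (Fin 8)), x b * w a b))) := by
    rw [normalCoord]
    congr 1
    funext a
    have : (Finset.univ : Finset (Fin 8)) = insert 1 (insert 2 {3, 4, 5, 6, 7, 8}) := by decide
    rw [this, Finset.sum_insert (by decide), Finset.sum_insert (by decide)]
    ring
  rw [h3, cplx_add, cplx_add, cplx_add, cplx_smul, cplx_smul, ← h2]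
  ext i
  simp only [Pi.add_apply, hw.cplx_sum, Pi.smul_apply, smul_eq_mul, Matrix.mulVec, dotProduct]
  have h4 : ∀ j, normalCoord (F t) (X t) j = cplx x j := fun j => rfl
  have h5 : ∀ k, normalCoord (F t) (F' k) = cplx (fun a => w a k) := fun k => rfl
  simp only [h4, h5, Finset.mul_sum, mul_comm]
  ring

/-- The vector normal to `F₁ ∧ F₂` with given complex coordinates. -/
def ofNormalCoord (F : Fin 8 → Oct) (z : Fin 3 → ℂ) : Oct :=
  (z 0).re • F 3 + (z 0).im • F 4 + (z 1).re • F 6 - (z 1).im • F 7 + (z 2).re • F 5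
    - (z 2).im • F 8

theorem IsAdaptedFrame.inner_eq {F : Fin 8 → Oct} (hF : IsAdaptedFrame F) (a b : Fin 8) :
    ⟪F a, F b⟫_ℝ = if a = b then 1 else 0 := orthonormal_iff_ite.1 hF.1 a b

theorem IsAdaptedFrame.eq_add_ofNormalCoord {F : Fin 8 → Oct} (hF : IsAdaptedFrame F) (X : Oct) :
    X = ⟪F 1, X⟫_ℝ • F 1 + ⟪F 2, X⟫_ℝ • F 2 + ofNormalCoord F (normalCoord F X) := by
  nth_rw 1 [← hF.sum_inner_smul X]
  simp [Fin.sum_univ_eight, ofNormalCoord, normalCoord, cplx]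
  abel

theorem IsAdaptedFrame.normalCoord_ofNormalCoord {F : Fin 8 → Oct} (hF : IsAdaptedFrame F)
    (z : Fin 3 → ℂ) : normalCoord F (ofNormalCoord F z) = z := by
  ext i
  fin_cases i <;> simp [normalCoord, ofNormalCoord, cplx, inner_add_right, inner_sub_right,
    inner_smul_right, hF.inner_eq, hF.1.1, Complex.ext_iff]

theorem ofNormalCoord_smul (F : Fin 8 → Oct) (c : ℂ) (z : Fin 3 → ℂ) :
    ofNormalCoord F (c • z)
      = c.re • ofNormalCoord F z + c.im • ofNormalCoord F (Complex.I • z) := by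
  simp only [ofNormalCoord, Pi.smul_apply, smul_eq_mul, Complex.mul_re, Complex.mul_im,
    Complex.I_re, Complex.I_im]
  module

theorem IsAdaptedFrame.inner_ofNormalCoord {F : Fin 8 → Oct} (hF : IsAdaptedFrame F)
    (z z' : Fin 3 → ℂ) : ⟪ofNormalCoord F z, ofNormalCoord F z'⟫_ℝ
      = ∑ i, ((z i).re * (z' i).re + (z i).im * (z' i).im) := by
  simp [ofNormalCoord, inner_add_right, inner_sub_right, inner_add_left, inner_sub_left,
    inner_smul_right, inner_smul_left, hF.inner_eq, hF.1.1, Fin.sum_univ_three]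
  ring

theorem IsAdaptedFrame.inner_one_ofNormalCoord {F : Fin 8 → Oct} (hF : IsAdaptedFrame F)
    (z : Fin 3 → ℂ) : ⟪F 1, ofNormalCoord F z⟫_ℝ = 0 := by
  simp [ofNormalCoord, inner_add_right, inner_sub_right, inner_smul_right, hF.inner_eq]

theorem IsAdaptedFrame.inner_two_ofNormalCoord {F : Fin 8 → Oct} (hF : IsAdaptedFrame F)
    (z : Fin 3 → ℂ) : ⟪F 2, ofNormalCoord F z⟫_ℝ = 0 := by
  simp [ofNormalCoord, inner_add_right, inner_sub_right, inner_smul_right, hF.inner_eq]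

/-! ### Parallel families of subspaces -/

/-- An orthonormal frame whose derivatives lie in its span has constant span. -/
theorem mem_span_of_fderiv_mem_span {ι : Type*} [Fintype ι] {f : ι → ℂ → Oct} {q₀ : ℂ} {r : ℝ}
    (hr : 0 < r) (hf : ∀ i, ∀ q ∈ Metric.ball q₀ r, DifferentiableAt ℝ (f i) q)
    (ho : ∀ q ∈ Metric.ball q₀ r, Orthonormal ℝ fun i => f i q)
    (hD : ∀ q ∈ Metric.ball q₀ r, ∀ u i,
      fderiv ℝ (f i) q u ∈ Submodule.span ℝ (Set.range fun j => f j q))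
    {q : ℂ} (hq : q ∈ Metric.ball q₀ r) (i : ι) :
    f i q ∈ Submodule.span ℝ (Set.range fun j => f j q₀) := by
  classical
  have hproj : ∀ p ∈ Metric.ball q₀ r, ∀ x ∈ Submodule.span ℝ (Set.range fun j => f j p),
      x = ∑ j, ⟪f j p, x⟫_ℝ • f j p := by
    intro p hp x hx
    obtain ⟨c, rfl⟩ := (Submodule.mem_span_range_iff_exists_fun ℝ).1 hx
    refine Finset.sum_congr rfl fun j _ => ?_
    rw [(ho p hp).inner_right_fintype]
  -- `G w p` is the orthogonal projection of `w` to the span at `p`. It suffices that it does not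
  -- depend on `p`.
  let G : Oct → ℂ → Oct := fun w p => ∑ j, ⟪f j p, w⟫_ℝ • f j p
  have hG : ∀ w, ∀ p ∈ Metric.ball q₀ r, HasFDerivAt (G w) (0 : ℂ →L[ℝ] Oct) p := by
    intro w p hp
    have h1 : ∀ j, HasFDerivAt (fun p => ⟪f j p, w⟫_ℝ • f j p)
        (⟪f j p, w⟫_ℝ • fderiv ℝ (f j) p
          + ((innerSL ℝ w).comp (fderiv ℝ (f j) p)).smulRight (f j p)) p := by
      intro j
      have h2 : HasFDerivAt (fun p => ⟪f j p, w⟫_ℝ) ((innerSL ℝ w).comp (fderiv ℝ (f j) p)) p := by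
        have := (innerSL ℝ w).hasFDerivAt.comp p (hf j p hp).hasFDerivAt
        refine this.congr_of_eventuallyEq (Eventually.of_forall fun y => ?_)
        simp [real_inner_comm]
      exact h2.smul (hf j p hp).hasFDerivAt
    have h3 := HasFDerivAt.fun_sum (u := Finset.univ) fun j _ => h1 j
    refine h3.congr_fderiv (ContinuousLinearMap.ext fun u => ?_)
    -- The matrix of the derivatives in the frame itself is skew, so the variation of the
    -- coefficients cancels that of the vectors.
    have hskew : ∀ j k, ⟪f j p, fderiv ℝ (f k) p u⟫_ℝ = -⟪f k p, fderiv ℝ (f j) p u⟫_ℝ := by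
      intro j k
      have h4 := ((hf j p hp).hasFDerivAt.inner ℝ (hf k p hp).hasFDerivAt)
      have h5 : HasFDerivAt (fun p => ⟪f j p, f k p⟫_ℝ) (0 : ℂ →L[ℝ] ℝ) p := by
        refine (hasFDerivAt_const (if j = k then (1 : ℝ) else 0) p).congr_of_eventuallyEq ?_
        filter_upwards [Metric.isOpen_ball.mem_nhds hp] with y hy
        exact orthonormal_iff_ite.1 (ho y hy) j k
      have h6 := congrArg (fun L : ℂ →L[ℝ] ℝ => L u) (h4.unique h5)
      simp at h6
      rw [real_inner_comm (fderiv ℝ (f j) p u)]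
      linarith
    have h7 : ∀ j, fderiv ℝ (f j) p u = ∑ k, ⟪f k p, fderiv ℝ (f j) p u⟫_ℝ • f k p :=
      fun j => hproj p hp _ (hD p hp u j)
    have h8 : ∑ j, ⟪f j p, w⟫_ℝ • fderiv ℝ (f j) p u
        = -∑ j, ⟪w, fderiv ℝ (f j) p u⟫_ℝ • f j p := by
      calc ∑ j, ⟪f j p, w⟫_ℝ • fderiv ℝ (f j) p u
          = ∑ j, ∑ k, (⟪f j p, w⟫_ℝ * ⟪f k p, fderiv ℝ (f j) p u⟫_ℝ) • f k p := by
            refine Finset.sum_congr rfl fun j _ => ?_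
            conv_lhs => rw [h7 j]
            simp only [Finset.smul_sum, smul_smul]
        _ = ∑ k, ∑ j, (⟪f j p, w⟫_ℝ * ⟪f k p, fderiv ℝ (f j) p u⟫_ℝ) • f k p := Finset.sum_comm
        _ = -∑ j, ⟪w, fderiv ℝ (f j) p u⟫_ℝ • f j p := by
            rw [← Finset.sum_neg_distrib]
            refine Finset.sum_congr rfl fun k _ => ?_
            conv_rhs => rw [h7 k]
            rw [inner_sum, ← neg_smul, ← Finset.sum_smul, ← Finset.sum_neg_distrib]
            congr 1
            refine Finset.sum_congr rfl fun j _ => ?_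
            rw [inner_smul_right, hskew k j, real_inner_comm]; ring
    simp only [sum_apply, add_apply, smul_apply,
      ContinuousLinearMap.smulRight_apply, ContinuousLinearMap.comp_apply, innerSL_apply_apply,
      Finset.sum_add_distrib, zero_apply]
    rw [h8]; simp
  have hconst : ∀ w, G w q = G w q₀ := by
    intro w
    refine (convex_ball q₀ r).is_const_of_fderivWithin_eq_zero (𝕜 := ℝ)
      (fun p hp => (hG w p hp).differentiableAt.differentiableWithinAt) (fun p hp => ?_) hq
      (Metric.mem_ball_self hr)
    rw [fderivWithin_of_isOpen Metric.isOpen_ball hp, (hG w p hp).fderiv]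
  have h9 := hproj q hq (f i q) (Submodule.subset_span ⟨i, rfl⟩)
  have h10 := hconst (f i q)
  simp only [G] at h10
  rw [h9, h10]
  exact Submodule.sum_mem _ fun j _ => Submodule.smul_mem _ _ (Submodule.subset_span ⟨j, rfl⟩)

end

end Cayley

namespace Cayley

open Filter Topology

noncomputable section

/-! ### Flatness of the asymptotic cone over an open set of the plane -/

theorem contDiffOn_normalCoord {Ω : Set ℂ} {e : ℂ → Fin 8 → Oct}
    (he : ∀ i, ContDiffOn ℝ ∞ (fun q => e q i) Ω) {X : ℂ → Oct} (hX : ContDiffOn ℝ ∞ X Ω) :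
    ContDiffOn ℝ ∞ (fun q => normalCoord (e q) (X q)) Ω := by
  have h : ∀ a, ContDiffOn ℝ ∞ (fun q => ((⟪e q a, X q⟫_ℝ : ℝ) : ℂ)) Ω := fun a =>
    Complex.ofRealCLM.contDiff.comp_contDiffOn ((he a).inner ℝ hX)
  refine contDiffOn_pi.2 fun i => ?_
  fin_cases i
  · exact (h 3).add (contDiffOn_const.mul (h 4))
  · exact (h 6).sub (contDiffOn_const.mul (h 7))
  · exact (h 5).sub (contDiffOn_const.mul (h 8))

/-- `[θ̄]x` is the cross product `x × θ̄`, which vanishes for `x` conjugate to a multiple of `b`, as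
`θ` is also a multiple of `b`. This removes the only antilinear term of the covariant derivative. -/
theorem bracketMat_mulVec_eq_zero {w : Fin 8 → Fin 8 → ℝ} {b : Fin 3 → ℂ} {τ c : ℂ}
    (h : thetaVec w = τ • b) :
    (bracketMat w).mulVec (fun j => starRingEnd ℂ ((c • b) j)) = 0 := by
  ext i
  fin_cases i <;>
  · simp [bracketMat, h, Matrix.mulVec, dotProduct, Fin.sum_univ_three]
    ring

/-- The covariant derivative along `u` of a complex multiple of `b`, modulo `b`, when `de₁` and
`de₂` are complex multiples of `b`. -/
theorem normalCoord_fderiv_of_eq_smul {e : ℂ → Fin 8 → Oct} {q u : ℂ}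
    (he : ∀ i, DifferentiableAt ℝ (fun p => e p i) q) (ha : ∀ᶠ p in 𝓝 q, IsAdaptedFrame (e p))
    {b : ℂ → Fin 3 → ℂ} (hb : DifferentiableAt ℝ b q)
    (h1 : ∃ τ : ℂ, normalCoord (e q) (fderiv ℝ (fun p => e p 1) q u) = τ • b q)
    (h2 : ∃ τ : ℂ, normalCoord (e q) (fderiv ℝ (fun p => e p 2) q u) = τ • b q) :
    ∃ Y : Fin 3 → ℂ, ∀ (X : ℂ → Oct) (c : ℂ → ℂ), DifferentiableAt ℝ X q → DifferentiableAt ℝ c q →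
      (∀ᶠ p in 𝓝 q, normalCoord (e p) (X p) = c p • b p) →
      ∃ τ : ℂ, normalCoord (e q) (fderiv ℝ X q u) = c q • Y + τ • b q := by
  set w := velocity (e q) (fun i => fderiv ℝ (fun p => e p i) q u) with hw
  obtain ⟨τ₁, h1⟩ := h1
  obtain ⟨τ₂, h2⟩ := h2
  -- `Y` depends on the frame, `b` and `u` only, so one `Y` serves for the derivatives of `e_k`, of
  -- `s` and of `b` itself.
  refine ⟨fderiv ℝ b q u + (kappaMat w).mulVec (b q), fun X c hX hc hev => ?_⟩
  have hcont : Tendsto (fun t : ℝ => q + t • u) (𝓝 0) (𝓝 q) := by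
    have : ContinuousAt (fun t : ℝ => q + t • u) 0 := by fun_prop
    simpa [ContinuousAt] using this
  have hl : ∀ {E : Type} [NormedAddCommGroup E] [NormedSpace ℝ E] {f : ℂ → E},
      DifferentiableAt ℝ f q → HasDerivAt (fun t : ℝ => f (q + t • u)) (fderiv ℝ f q u) 0 :=
    fun hf => hf.hasFDerivAt.hasLineDerivAt u
  have hZ : HasDerivAt (fun t : ℝ => normalCoord (e (q + t • u)) (X (q + t • u)))
      (c q • fderiv ℝ b q u + fderiv ℝ c q u • b q) 0 := by
    have := (hl hc).smul (hl hb)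
    simp only [zero_smul, add_zero] at this
    exact this.congr_of_eventuallyEq (hcont.eventually hev)
  have key := normalCoord_deriv_eq (F := fun t => e (q + t • u)) (hcont.eventually ha)
    (fun i => hl (he i)) (hl hX) hZ
  simp only [zero_smul, add_zero] at key
  have hθ : thetaVec w = (τ₁ + Complex.I * τ₂) • b q := by
    change normalCoord (e q) (fderiv ℝ (fun p => e p 1) q u)
      + Complex.I • normalCoord (e q) (fderiv ℝ (fun p => e p 2) q u) = _
    rw [h1, h2]; module
  rw [hev.self_of_nhds, bracketMat_mulVec_eq_zero hθ, h1, h2, Matrix.mulVec_smul] at key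
  refine ⟨fderiv ℝ c q u + (⟪e q 1, X q⟫_ℝ : ℂ) * τ₁ + (⟪e q 2, X q⟫_ℝ : ℂ) * τ₂, ?_⟩
  rw [key]
  module

/-- Vanishing of the bilinear cross product is complex proportionality. The coefficient is given
explicitly, as the hermitian product with `b`, because it has to be differentiated. -/
theorem eq_smul_of_cross_eq_zero {b z : Fin 3 → ℂ} (hb : ∑ i, starRingEnd ℂ (b i) * b i = 1)
    (h : crossProduct z b = 0) : z = (∑ i, starRingEnd ℂ (b i) * z i) • b := by
  have h0 := congrFun h 0
  have h1 := congrFun h 1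
  have h2 := congrFun h 2
  simp [cross_apply] at h0 h1 h2
  rw [Fin.sum_univ_three] at hb
  ext i
  simp only [Fin.sum_univ_three, Pi.smul_apply, smul_eq_mul]
  fin_cases i <;> simp
  · linear_combination -(z 0) * hb - starRingEnd ℂ (b 2) * h1 + starRingEnd ℂ (b 1) * h2
  · linear_combination -(z 1) * hb + starRingEnd ℂ (b 2) * h0 - starRingEnd ℂ (b 0) * h2
  · linear_combination -(z 2) * hb - starRingEnd ℂ (b 1) * h0 + starRingEnd ℂ (b 0) * h1

/-- The hermitian norm of a vector of `ℂ³`. -/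
def hnorm (z : Fin 3 → ℂ) : ℝ := √(∑ i, Complex.normSq (z i))

theorem hnorm_pos {z : Fin 3 → ℂ} (hz : z ≠ 0) : 0 < ∑ i, Complex.normSq (z i) := by
  obtain ⟨i, hi⟩ := Function.ne_iff.1 hz
  exact Finset.sum_pos' (fun _ _ => Complex.normSq_nonneg _)
    ⟨i, Finset.mem_univ _, Complex.normSq_pos.2 hi⟩

theorem sum_normSq_unit {z : Fin 3 → ℂ} (hz : z ≠ 0) :
    ∑ i, Complex.normSq (((hnorm z : ℂ)⁻¹ • z) i) = 1 := by
  have h := hnorm_pos hz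
  simp only [Pi.smul_apply, smul_eq_mul, map_mul, ← Finset.mul_sum, map_inv₀,
    Complex.normSq_ofReal]
  rw [hnorm, Real.mul_self_sqrt h.le, inv_mul_cancel₀ h.ne']

theorem differentiableAt_hnorm {B : ℂ → Fin 3 → ℂ} {q : ℂ} (hB : DifferentiableAt ℝ B q)
    (h : B q ≠ 0) : DifferentiableAt ℝ (fun p => hnorm (B p)) q := by
  have h1 : ∀ i, DifferentiableAt ℝ (fun p => B p i) q := differentiableAt_pi.1 hB
  refine DifferentiableAt.sqrt ?_ (hnorm_pos h).ne'
  refine DifferentiableAt.fun_sum fun i _ => ?_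
  simp only [Complex.normSq_apply]
  have hre := Complex.reCLM.differentiableAt.comp q (h1 i)
  have him := Complex.imCLM.differentiableAt.comp q (h1 i)
  exact (hre.mul hre).add (him.mul him)

end

end Cayley

namespace Cayley

open Filter Topology

noncomputable section

theorem two_le_infty : (2 : WithTop ℕ∞) ≤ ∞ := WithTop.coe_le_coe.2 (le_top : (2 : ℕ∞) ≤ ⊤)

theorem fderiv_fderiv_comm {f : ℂ → Oct} {q : ℂ} (hf : ContDiffAt ℝ ∞ f q) (u v : ℂ) :
    fderiv ℝ (fun p => fderiv ℝ f p u) q v = fderiv ℝ (fun p => fderiv ℝ f p v) q u := by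
  have h1 : DifferentiableAt ℝ (fderiv ℝ f) q :=
    (hf.fderiv_right (m := 1) (by rw [one_add_one_eq_two]; exact two_le_infty)).differentiableAt (by simp)
  have h2 : ∀ a c, fderiv ℝ (fun p => fderiv ℝ f p a) q c = fderiv ℝ (fderiv ℝ f) q c a := by
    intro a c
    have := h1.hasFDerivAt.clm_apply (hasFDerivAt_const a q)
    rw [this.fderiv]; simp
  rw [h2, h2]
  exact hf.isSymmSndFDerivAt (by simpa using two_le_infty) v u

theorem fderiv_apply_eq (f : ℂ → Oct) (q u : ℂ) :
    fderiv ℝ f q u = u.re • fderiv ℝ f q 1 + u.im • fderiv ℝ f q Complex.I := by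
  rw [← map_smul, ← map_smul, ← map_add]
  congr 1
  simp

/-- The orthonormal frame `F₁`, `F₂`, `b`, `i b` of the plane spanned by `F₁ ∧ F₂` and a complex
normal direction. -/
def tangentFrame (F : Fin 8 → Oct) (b : Fin 3 → ℂ) : Fin 4 → Oct :=
  ![F 1, F 2, ofNormalCoord F b, ofNormalCoord F (Complex.I • b)]

theorem IsAdaptedFrame.orthonormal_tangentFrame {F : Fin 8 → Oct} (hF : IsAdaptedFrame F)
    {b : Fin 3 → ℂ} (hb : ∑ i, Complex.normSq (b i) = 1) : Orthonormal ℝ (tangentFrame F b) := by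
  have h1 := hF.inner_one_ofNormalCoord
  have h2 := hF.inner_two_ofNormalCoord
  have h1' : ∀ z, ⟪ofNormalCoord F z, F 1⟫_ℝ = 0 := fun z => by rw [real_inner_comm, h1]
  have h2' : ∀ z, ⟪ofNormalCoord F z, F 2⟫_ℝ = 0 := fun z => by rw [real_inner_comm, h2]
  have h3 : ∀ z, ‖ofNormalCoord F z‖ ^ 2 = ∑ i, Complex.normSq (z i) := fun z => by
    rw [← real_inner_self_eq_norm_sq, hF.inner_ofNormalCoord]
    simp [Complex.normSq_apply]
  rw [orthonormal_iff_ite]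
  simp only [Complex.normSq_apply, Fin.sum_univ_three] at hb
  intro i j
  fin_cases i <;> fin_cases j <;>
    simp [tangentFrame, h1, h2, h1', h2', h3, hF.inner_eq, hF.1.1, hF.inner_ofNormalCoord,
      Fin.sum_univ_three, Complex.normSq_apply] <;> linarith

theorem IsAdaptedFrame.mem_span_tangentFrame {F : Fin 8 → Oct} (hF : IsAdaptedFrame F)
    {b : Fin 3 → ℂ} {X : Oct} {τ : ℂ} (h : normalCoord F X = τ • b) :
    X ∈ Submodule.span ℝ (Set.range (tangentFrame F b)) := by
  rw [hF.eq_add_ofNormalCoord X, h, ofNormalCoord_smul]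
  have hm : ∀ i, tangentFrame F b i ∈ Submodule.span ℝ (Set.range (tangentFrame F b)) :=
    fun i => Submodule.subset_span ⟨i, rfl⟩
  exact add_mem (add_mem (Submodule.smul_mem _ _ (hm 0)) (Submodule.smul_mem _ _ (hm 1)))
    (add_mem (Submodule.smul_mem _ _ (hm 2)) (Submodule.smul_mem _ _ (hm 3)))

theorem differentiableAt_ofNormalCoord {e : ℂ → Fin 8 → Oct} {q : ℂ}
    (he : ∀ i, DifferentiableAt ℝ (fun p => e p i) q) {b : ℂ → Fin 3 → ℂ}
    (hb : DifferentiableAt ℝ b q) : DifferentiableAt ℝ (fun p => ofNormalCoord (e p) (b p)) q := by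
  have h1 : ∀ i, DifferentiableAt ℝ (fun p => b p i) q := differentiableAt_pi.1 hb
  have hre : ∀ i, DifferentiableAt ℝ (fun p => (b p i).re) q := fun i =>
    Complex.reCLM.differentiableAt.comp q (h1 i)
  have him : ∀ i, DifferentiableAt ℝ (fun p => (b p i).im) q := fun i =>
    Complex.imCLM.differentiableAt.comp q (h1 i)
  exact ((((((hre 0).smul (he 3)).add ((him 0).smul (he 4))).add ((hre 1).smul (he 6))).sub
    ((him 1).smul (he 7))).add ((hre 2).smul (he 5))).sub ((him 2).smul (he 8))

/-- The complex normal direction `b` is parallel modulo the plane it spans with `e₁ ∧ e₂`, where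
`de₁` or `de₂` does not vanish modulo that plane and the normal part `A` of `ds` is not of type
`(1,0)`. -/
theorem exists_smul_of_symmetric {Y₁ Y₂ b : Fin 3 → ℂ} {c f τ₁ τ₂ τ₃ τ₄ : ℂ} {N : ℂ} (hc : c ≠ 0)
    (hN : N ≠ 0) (h1 : c • Y₂ + τ₁ • b = (Complex.I * c) • Y₁ + τ₂ • b)
    (h2 : f • Y₂ + τ₃ • b = (N + Complex.I * f) • Y₁ + τ₄ • b) :
    (∃ τ : ℂ, Y₁ = τ • b) ∧ ∃ τ : ℂ, Y₂ = τ • b := by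
  have h3 : Y₂ = Complex.I • Y₁ + (c⁻¹ * (τ₂ - τ₁)) • b := by
    ext i
    have := congrFun h1 i
    simp only [Pi.add_apply, Pi.smul_apply, smul_eq_mul] at this ⊢
    field_simp
    linear_combination this
  -- Inserting `Y₂ = iY₁` modulo `b` into the second equation cancels the terms `i f Y₁` and leaves
  -- `N Y₁`.
  have h4 : Y₁ = (N⁻¹ * (f * (c⁻¹ * (τ₂ - τ₁)) + τ₃ - τ₄)) • b := by
    ext i
    have := congrFun h2 i
    rw [h3] at this
    simp only [Pi.add_apply, Pi.smul_apply, smul_eq_mul] at this ⊢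
    field_simp at this ⊢
    linear_combination -this
  refine ⟨⟨_, h4⟩, ⟨Complex.I * (N⁻¹ * (f * (c⁻¹ * (τ₂ - τ₁)) + τ₃ - τ₄)) + c⁻¹ * (τ₂ - τ₁), ?_⟩⟩
  rw [h3, h4]
  module

/-- Over a domain of the plane: if the reduced equations hold and the normal part of `ds` is nowhere
of type `(1,0)`, then the planes `e₁ ∧ e₂` over some ball lie in one subspace of dimension four. -/
theorem exists_flat_ball {Ω : Set ℂ} (hΩ : IsOpen Ω) (hne : Ω.Nonempty) {e : ℂ → Fin 8 → Oct}
    (he : ∀ i, ContDiffOn ℝ ∞ (fun q => e q i) Ω) (ha : ∀ q ∈ Ω, IsAdaptedFrame (e q))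
    {s : ℂ → Oct} (hs : ContDiffOn ℝ ∞ s Ω)
    (hz : ∀ q ∈ Ω, ∀ k ∈ ({1, 2} : Finset (Fin 8)),
      normalCoord (e q) (fderiv ℝ (fun p => e p k) q Complex.I)
        = Complex.I • normalCoord (e q) (fderiv ℝ (fun p => e p k) q 1))
    {B : ℂ → Fin 3 → ℂ}
    (hB : ∀ q, B q = normalCoord (e q) (fderiv ℝ s q Complex.I)
      - Complex.I • normalCoord (e q) (fderiv ℝ s q 1))
    (hB0 : ∀ q ∈ Ω, B q ≠ 0)
    (hzB : ∀ q ∈ Ω, ∀ k ∈ ({1, 2} : Finset (Fin 8)),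
      crossProduct (normalCoord (e q) (fderiv ℝ (fun p => e p k) q 1)) (B q) = 0)
    (hAB : ∀ q ∈ Ω, crossProduct (normalCoord (e q) (fderiv ℝ s q 1)) (B q) = 0) :
    ∃ q₀ r, 0 < r ∧ Metric.ball q₀ r ⊆ Ω ∧ ∃ P : Submodule ℝ Oct, Module.finrank ℝ P ≤ 4 ∧
      ∀ q ∈ Metric.ball q₀ r, e q 1 ∈ P ∧ e q 2 ∈ P := by
  have hD : ∀ {f : ℂ → Oct}, ContDiffOn ℝ ∞ f Ω → ∀ u,
      ContDiffOn ℝ ∞ (fun q => fderiv ℝ f q u) Ω := fun hf u =>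
    (hf.fderiv_of_isOpen hΩ (by simp)).clm_apply contDiffOn_const
  have hdiff : ∀ {E : Type} [NormedAddCommGroup E] [NormedSpace ℝ E] {f : ℂ → E},
      ContDiffOn ℝ ∞ f Ω → ∀ q ∈ Ω, DifferentiableAt ℝ f q := fun hf q hq =>
    (hf.contDiffAt (hΩ.mem_nhds hq)).differentiableAt (by simp)
  have hBs : ContDiffOn ℝ ∞ B Ω := by
    have : B = fun q => normalCoord (e q) (fderiv ℝ s q Complex.I)
      - Complex.I • normalCoord (e q) (fderiv ℝ s q 1) := funext hB
    rw [this]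
    exact (contDiffOn_normalCoord he (hD hs _)).sub
      ((contDiffOn_normalCoord he (hD hs _)).const_smul Complex.I)
  let N : ℂ → ℂ := fun q => (hnorm (B q) : ℂ)
  let b : ℂ → Fin 3 → ℂ := fun q => (N q)⁻¹ • B q
  have hN0 : ∀ q ∈ Ω, N q ≠ 0 := fun q hq => by
    simpa [N, hnorm] using (Real.sqrt_pos.2 (hnorm_pos (hB0 q hq))).ne'
  have hNd : ∀ q ∈ Ω, DifferentiableAt ℝ N q := fun q hq =>
    Complex.ofRealCLM.differentiableAt.comp q (differentiableAt_hnorm (hdiff hBs q hq) (hB0 q hq))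
  have hbd : ∀ q ∈ Ω, DifferentiableAt ℝ b q := fun q hq =>
    ((hNd q hq).inv (hN0 q hq)).smul (hdiff hBs q hq)
  have hBb : ∀ q ∈ Ω, B q = N q • b q := fun q hq => by
    simp only [b, smul_smul, mul_inv_cancel₀ (hN0 q hq), one_smul]
  have hb1 : ∀ q ∈ Ω, ∑ i, Complex.normSq (b q i) = 1 := fun q hq => sum_normSq_unit (hB0 q hq)
  have hb1' : ∀ q ∈ Ω, ∑ i, starRingEnd ℂ (b q i) * b q i = 1 := fun q hq => by
    have := congrArg (fun x : ℝ => (x : ℂ)) (hb1 q hq)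
    simpa [Complex.normSq_eq_conj_mul_self] using this
  have hpar : ∀ q ∈ Ω, ∀ z, crossProduct z (B q) = 0 →
      z = (∑ i, starRingEnd ℂ (b q i) * z i) • b q := fun q hq z hz =>
    eq_smul_of_cross_eq_zero (hb1' q hq) (by simp only [b]; rw [map_smul, hz, smul_zero])
  have hcd : ∀ {X : ℂ → Oct}, ContDiffOn ℝ ∞ X Ω → ∀ q ∈ Ω, DifferentiableAt ℝ
      (fun q => ∑ i, starRingEnd ℂ (b q i) * normalCoord (e q) (X q) i) q := by
    intro X hX q hq
    refine DifferentiableAt.fun_sum fun i _ => ?_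
    have h1 := differentiableAt_pi.1 (hbd q hq) i
    have h2 := differentiableAt_pi.1 (hdiff (contDiffOn_normalCoord he hX) q hq) i
    exact (Complex.conjCLE.differentiableAt.comp q h1).mul h2
  let c : Fin 8 → ℂ → ℂ := fun k q =>
    ∑ i, starRingEnd ℂ (b q i) * normalCoord (e q) (fderiv ℝ (fun p => e p k) q 1) i
  have hc1 : ∀ q ∈ Ω, ∀ k ∈ ({1, 2} : Finset (Fin 8)),
      normalCoord (e q) (fderiv ℝ (fun p => e p k) q 1) = c k q • b q := fun q hq k hk =>
    hpar q hq _ (hzB q hq k hk)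
  have hcI : ∀ q ∈ Ω, ∀ k ∈ ({1, 2} : Finset (Fin 8)),
      normalCoord (e q) (fderiv ℝ (fun p => e p k) q Complex.I) = (Complex.I * c k q) • b q :=
    fun q hq k hk => by rw [hz q hq k hk, hc1 q hq k hk, smul_smul]
  have hspan : ∀ q ∈ Ω, ∀ {X : ℂ → Oct}, (∃ τ : ℂ, normalCoord (e q) (fderiv ℝ X q 1) = τ • b q) →
      (∃ τ : ℂ, normalCoord (e q) (fderiv ℝ X q Complex.I) = τ • b q) → ∀ u,
      fderiv ℝ X q u ∈ Submodule.span ℝ (Set.range (tangentFrame (e q) (b q))) := by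
    rintro q hq X ⟨τ, h1⟩ ⟨τ', h2⟩ u
    rw [fderiv_apply_eq]
    exact add_mem (Submodule.smul_mem _ _ ((ha q hq).mem_span_tangentFrame h1))
      (Submodule.smul_mem _ _ ((ha q hq).mem_span_tangentFrame h2))
  -- If `de₁` or `de₂` has a normal part at some point, the 4-space spanned by `e₁, e₂, b, ib` is
  -- constant nearby; if neither has one anywhere, already the plane `e₁ ∧ e₂` is.
  by_cases hcase : ∃ q₀ ∈ Ω, ∃ k ∈ ({1, 2} : Finset (Fin 8)), c k q₀ ≠ 0
  · obtain ⟨q₀, hq₀, k, hk, hck⟩ := hcase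
    have hev : ∀ᶠ q in 𝓝 q₀, q ∈ Ω ∧ c k q ≠ 0 :=
      Filter.Eventually.and (hΩ.mem_nhds hq₀) ((hcd (hD (he k) 1) q₀ hq₀).continuousAt.eventually_ne hck)
    obtain ⟨r, hr, hball⟩ := Metric.eventually_nhds_iff_ball.1 hev
    refine ⟨q₀, r, hr, fun q hq => (hball q hq).1,
      Submodule.span ℝ (Set.range (tangentFrame (e q₀) (b q₀))), ?_, fun q hq => ?_⟩
    · exact (finrank_range_le_card (R := ℝ) (tangentFrame (e q₀) (b q₀))).trans (by simp)
    have hfd : ∀ i, ∀ q ∈ Ω, DifferentiableAt ℝ (fun q => tangentFrame (e q) (b q) i) q := by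
      intro i q hq
      fin_cases i
      · exact hdiff (he 1) q hq
      · exact hdiff (he 2) q hq
      · exact differentiableAt_ofNormalCoord (fun i => hdiff (he i) q hq) (hbd q hq)
      · exact differentiableAt_ofNormalCoord (fun i => hdiff (he i) q hq)
          ((hbd q hq).const_smul Complex.I)
    have hfD : ∀ q ∈ Metric.ball q₀ r, ∀ u i, fderiv ℝ (fun q => tangentFrame (e q) (b q) i) q u
        ∈ Submodule.span ℝ (Set.range (tangentFrame (e q) (b q))) := by
      intro q hq u i
      obtain ⟨hqΩ, hckq⟩ := hball q hq
      have hΩev : ∀ᶠ p in 𝓝 q, p ∈ Ω := hΩ.mem_nhds hqΩ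
      have hI1 : (1 : Fin 8) ∈ ({1, 2} : Finset (Fin 8)) := by decide
      have hI2 : (2 : Fin 8) ∈ ({1, 2} : Finset (Fin 8)) := by decide
      obtain ⟨Y₁, hY₁⟩ := normalCoord_fderiv_of_eq_smul (u := 1) (fun i => hdiff (he i) q hqΩ)
        (hΩev.mono ha) (hbd q hqΩ) ⟨_, hc1 q hqΩ 1 hI1⟩ ⟨_, hc1 q hqΩ 2 hI2⟩
      obtain ⟨Y₂, hY₂⟩ := normalCoord_fderiv_of_eq_smul (u := Complex.I)
        (fun i => hdiff (he i) q hqΩ)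
        (hΩev.mono ha) (hbd q hqΩ) ⟨_, hcI q hqΩ 1 hI1⟩ ⟨_, hcI q hqΩ 2 hI2⟩
      have hckd := hcd (hD (he k) 1) q hqΩ
      have hfdq := hcd (hD hs 1) q hqΩ
      set f : ℂ → ℂ := fun q => ∑ i, starRingEnd ℂ (b q i) * normalCoord (e q) (fderiv ℝ s q 1) i
      have hf1 : ∀ p ∈ Ω, normalCoord (e p) (fderiv ℝ s p 1) = f p • b p := fun p hp =>
        hpar p hp _ (hAB p hp)
      have hfI : ∀ p ∈ Ω, normalCoord (e p) (fderiv ℝ s p Complex.I)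
          = (N p + Complex.I * f p) • b p := fun p hp => by
        have h5 := hB p
        rw [hBb p hp, hf1 p hp] at h5
        rw [add_smul, h5, mul_smul, sub_add_cancel]
      obtain ⟨τ₁, h1⟩ := hY₂ _ (c k) (hdiff (hD (he k) 1) q hqΩ) hckd
        (hΩev.mono fun p hp => hc1 p hp k hk)
      obtain ⟨τ₂, h2⟩ := hY₁ _ (fun p => Complex.I * c k p) (hdiff (hD (he k) Complex.I) q hqΩ)
        (hckd.const_mul _) (hΩev.mono fun p hp => hcI p hp k hk)
      obtain ⟨τ₃, h3⟩ := hY₂ _ f (hdiff (hD hs 1) q hqΩ) hfdq (hΩev.mono hf1)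
      obtain ⟨τ₄, h4⟩ := hY₁ _ (fun p => N p + Complex.I * f p) (hdiff (hD hs Complex.I) q hqΩ)
        ((hNd q hqΩ).add (hfdq.const_mul _)) (hΩev.mono hfI)
      -- The mixed second derivatives of `e_k`, then of `s`, computed in both orders: the two
      -- equations of `exists_smul_of_symmetric`.
      rw [fderiv_fderiv_comm ((he k).contDiffAt hΩev), h2] at h1
      rw [fderiv_fderiv_comm (hs.contDiffAt hΩev), h4] at h3
      obtain ⟨⟨σ₁, hσ₁⟩, ⟨σ₂, hσ₂⟩⟩ := exists_smul_of_symmetric hckq (hN0 q hqΩ) h1.symm h3.symm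
      -- The vectors `b` and `ib` are complex multiples of `b` with constant coefficient, so their
      -- derivatives have normal part in `ℂb` because `Y₁` and `Y₂` do.
      have hmul : ∀ {X : ℂ → Oct} (a : ℂ), DifferentiableAt ℝ X q →
          (∀ p ∈ Ω, normalCoord (e p) (X p) = a • b p) →
          fderiv ℝ X q u ∈ Submodule.span ℝ (Set.range (tangentFrame (e q) (b q))) := by
        intro X a hX hXb
        obtain ⟨τ, h6⟩ := hY₁ X (fun _ => a) hX (differentiableAt_const _) (hΩev.mono hXb)
        obtain ⟨τ', h7⟩ := hY₂ X (fun _ => a) hX (differentiableAt_const _) (hΩev.mono hXb)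
        refine hspan q hqΩ ⟨a * σ₁ + τ, ?_⟩ ⟨a * σ₂ + τ', ?_⟩ u
        · rw [h6, hσ₁]; module
        · rw [h7, hσ₂]; module
      have hfq := fun i => hfd i q hqΩ
      fin_cases i
      · exact hspan q hqΩ ⟨_, hc1 q hqΩ 1 hI1⟩ ⟨_, hcI q hqΩ 1 hI1⟩ u
      · exact hspan q hqΩ ⟨_, hc1 q hqΩ 2 hI2⟩ ⟨_, hcI q hqΩ 2 hI2⟩ u
      · exact hmul 1 (hfq 2) fun p hp => by
          rw [one_smul]; exact (ha p hp).normalCoord_ofNormalCoord _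
      · exact hmul Complex.I (hfq 3) fun p hp => (ha p hp).normalCoord_ofNormalCoord _
    have key := fun i => mem_span_of_fderiv_mem_span
      (f := fun i q => tangentFrame (e q) (b q) i) hr (fun i q hq => hfd i q (hball q hq).1)
      (fun q hq => (ha q (hball q hq).1).orthonormal_tangentFrame (hb1 q (hball q hq).1)) hfD hq i
    exact ⟨key 0, key 1⟩
  · push Not at hcase
    obtain ⟨q₀, hq₀⟩ := hne
    obtain ⟨r, hr, hball⟩ := Metric.isOpen_iff.1 hΩ q₀ hq₀
    refine ⟨q₀, r, hr, hball, Submodule.span ℝ (Set.range ![e q₀ 1, e q₀ 2]), ?_, fun q hq => ?_⟩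
    · refine (finrank_range_le_card (R := ℝ) ![e q₀ 1, e q₀ 2]).trans (by simp)
    have hmem : ∀ q ∈ Ω, ∀ X, normalCoord (e q) X = 0 →
        X ∈ Submodule.span ℝ (Set.range ![e q 1, e q 2]) := by
      intro q hq X hX
      rw [(ha q hq).eq_add_ofNormalCoord X, hX]
      have h0 : ofNormalCoord (e q) 0 = 0 := by simp [ofNormalCoord]
      rw [h0, add_zero]
      exact add_mem (Submodule.smul_mem _ _ (Submodule.subset_span ⟨0, rfl⟩))
        (Submodule.smul_mem _ _ (Submodule.subset_span ⟨1, rfl⟩))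
    have hk0 : ∀ q ∈ Ω, ∀ k ∈ ({1, 2} : Finset (Fin 8)), ∀ u, fderiv ℝ (fun p => e p k) q u
        ∈ Submodule.span ℝ (Set.range ![e q 1, e q 2]) := by
      intro q hq k hk u
      rw [fderiv_apply_eq]
      refine add_mem (Submodule.smul_mem _ _ (hmem q hq _ ?_))
        (Submodule.smul_mem _ _ (hmem q hq _ ?_))
      · rw [hc1 q hq k hk, hcase q hq k hk, zero_smul]
      · rw [hcI q hq k hk, hcase q hq k hk, mul_zero, zero_smul]
    have key := fun i => mem_span_of_fderiv_mem_span
      (f := fun i q => ![e q 1, e q 2] i) hr (fun i q hq => by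
        fin_cases i
        · exact hdiff (he 1) q (hball hq)
        · exact hdiff (he 2) q (hball hq))
      (fun q hq => by
        rw [orthonormal_iff_ite]
        intro i j
        fin_cases i <;> fin_cases j <;> simp [(ha q (hball hq)).inner_eq, (ha q (hball hq)).1.1])
      (fun q hq u i => by
        fin_cases i
        · exact hk0 q (hball hq) 1 (by decide) u
        · exact hk0 q (hball hq) 2 (by decide) u) hq i
    exact ⟨key 0, key 1⟩

end

end Cayley

namespace Cayley

open Filter Topology

noncomputable section

section Surface

variable {S : Type*} [TopologicalSpace S] [ChartedSpace ℂ S]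

/-! ### Derivatives in charts -/

theorem differentiableAt_comp_chart_symm {W : Type*} [NormedAddCommGroup W] [NormedSpace ℝ W]
    {f : S → W} {p : S} (hf : MDifferentiableAt 𝓘(ℝ, ℂ) 𝓘(ℝ, W) f p) :
    DifferentiableAt ℝ (f ∘ (chartAt ℂ p).symm) (chartAt ℂ p p) := by
  have h : DifferentiableWithinAt ℝ (f ∘ (chartAt ℂ p).symm) (Set.range id) (chartAt ℂ p p) :=
    ((mdifferentiableAt_iff f p).1 hf).2
  rwa [Set.range_id, differentiableWithinAt_univ] at h

theorem diff_apply {W : Type*} [NormedAddCommGroup W] [NormedSpace ℝ W] {f : S → W}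
    {p : S} (hf : MDifferentiableAt 𝓘(ℝ, ℂ) 𝓘(ℝ, W) f p) (v : Tan p) :
    diff f p v = fderiv ℝ (f ∘ (chartAt ℂ p).symm) (chartAt ℂ p p) v := by
  have h : diff f p v
      = fderivWithin ℝ (f ∘ (chartAt ℂ p).symm) (Set.range id) (chartAt ℂ p p) v :=
    congrArg (fun L : TangentSpace 𝓘(ℝ, ℂ) p →L[ℝ] TangentSpace 𝓘(ℝ, W) (f p) => L v) hf.mfderiv
  rw [h, Set.range_id, fderivWithin_univ]

/-- The image of a straight line in the chart at `p`. -/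
def chartLine (p : S) (v : ℂ) (t : ℝ) : S := (chartAt ℂ p).symm (chartAt ℂ p p + t • v)

theorem chartLine_zero (p : S) (v : ℂ) : chartLine p v 0 = p := by
  simp [chartLine]

theorem tendsto_chartLine (p : S) (v : ℂ) : Tendsto (chartLine p v) (𝓝 0) (𝓝 p) := by
  have h1 : ContinuousAt (fun t : ℝ => chartAt ℂ p p + t • v) 0 := by fun_prop
  have h2 : ContinuousAt (chartAt ℂ p).symm (chartAt ℂ p p + (0 : ℝ) • v) := by
    rw [zero_smul, add_zero]
    exact (chartAt ℂ p).symm.continuousAt (mem_chart_target ℂ p)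
  have h3 : ContinuousAt (chartLine p v) 0 :=
    ContinuousAt.comp (f := fun t : ℝ => chartAt ℂ p p + t • v) h2 h1
  simpa [ContinuousAt, chartLine_zero] using h3

/-- A curve through `p` with velocity `v`. -/
def curve (p : S) (v : Tan p) (t : ℝ) : S := chartLine p v t

theorem curve_zero (p : S) (v : Tan p) : curve p v 0 = p := chartLine_zero p v

theorem tendsto_curve (p : S) (v : Tan p) : Tendsto (curve p v) (𝓝 0) (𝓝 p) :=
  tendsto_chartLine p v

theorem hasDerivAt_curve {W : Type*} [NormedAddCommGroup W] [NormedSpace ℝ W] {f : S → W}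
    {p : S} (hf : MDifferentiableAt 𝓘(ℝ, ℂ) 𝓘(ℝ, W) f p) (v : Tan p) :
    HasDerivAt (fun t => f (curve p v t)) (diff f p v) 0 := by
  rw [diff_apply hf]
  exact (differentiableAt_comp_chart_symm hf).hasFDerivAt.hasLineDerivAt v

theorem contDiffOn_transition [IsManifold 𝓘(ℂ) ω S] {χ χ' : OpenPartialHomeomorph S ℂ}
    (h : χ ∈ atlas ℂ S) (h' : χ' ∈ atlas ℂ S) :
    ContDiffOn ℂ ω (χ' ∘ χ.symm) (χ.symm ≫ₕ χ').source := by
  have h1 := (contDiffGroupoid ω 𝓘(ℂ)).compatible h h'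
  rw [contDiffGroupoid, mem_groupoid_of_pregroupoid] at h1
  simpa [contDiffPregroupoid] using h1.1

theorem isManifold_real [IsManifold 𝓘(ℂ) ω S] : IsManifold 𝓘(ℝ, ℂ) ∞ S := by
  refine isManifold_of_contDiffOn _ _ _ fun χ χ' h h' => ?_
  have h1 := ((contDiffOn_transition h h').restrict_scalars ℝ).of_le (m := ∞) (by simp)
  simpa using h1

/-- The passage from the chart at `p` to the chart at `p₀`. -/
theorem exists_chart_transfer [IsManifold 𝓘(ℂ) ω S] {p₀ p : S} (hp : p ∈ (chartAt ℂ p₀).source) :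
    ∃ T : Tan p →L[ℝ] ℂ, Function.Surjective T ∧ (∀ v, T (rot p v) = Complex.I * T v) ∧
      ∀ {W : Type} [NormedAddCommGroup W] [NormedSpace ℝ W] {f : S → W},
        MDifferentiableAt 𝓘(ℝ, ℂ) 𝓘(ℝ, W) f p →
        ∀ v, diff f p v = fderiv ℝ (f ∘ (chartAt ℂ p₀).symm) (chartAt ℂ p₀ p) (T v) := by
  set φ := chartAt ℂ p₀
  set χ := chartAt ℂ p
  have hpχ : p ∈ χ.source := mem_chart_source ℂ p
  have htr : ∀ (x y : S), p ∈ (chartAt ℂ x).source → p ∈ (chartAt ℂ y).source →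
      DifferentiableAt ℂ (chartAt ℂ y ∘ (chartAt ℂ x).symm) (chartAt ℂ x p) := by
    intro x y hx hy
    refine ((contDiffOn_transition (chart_mem_atlas ℂ x) (chart_mem_atlas ℂ y)).contDiffAt
      ((OpenPartialHomeomorph.open_source _).mem_nhds ?_)).differentiableAt (by simp)
    simp [hx, hy]
  have h1 : DifferentiableAt ℂ (φ ∘ χ.symm) (χ p) := htr p p₀ hpχ hp
  have h2 : DifferentiableAt ℂ (χ ∘ φ.symm) (φ p) := htr p₀ p hp hpχ
  have h1R := h1.hasFDerivAt.restrictScalars ℝ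
  have h2R := h2.hasFDerivAt.restrictScalars ℝ
  have e1 : (φ ∘ χ.symm) (χ p) = φ p := by simp [hpχ]
  have e2 : (χ ∘ φ.symm) (φ p) = χ p := by simp [hp]
  -- The derivative of the holomorphic change of charts: complex linearity gives compatibility with
  -- `rot`, and the reverse change of charts gives surjectivity.
  refine ⟨(fderiv ℂ (φ ∘ χ.symm) (χ p)).restrictScalars ℝ, fun z => ?_, fun v => ?_, ?_⟩
  · refine ⟨fderiv ℂ (χ ∘ φ.symm) (φ p) z, ?_⟩
    have h3 : HasFDerivAt ((φ ∘ χ.symm) ∘ (χ ∘ φ.symm))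
        ((fderiv ℂ (φ ∘ χ.symm) (χ p)).comp (fderiv ℂ (χ ∘ φ.symm) (φ p))) (φ p) := by
      refine HasFDerivAt.comp _ ?_ h2.hasFDerivAt
      rw [e2]; exact h1.hasFDerivAt
    have h4 : HasFDerivAt ((φ ∘ χ.symm) ∘ (χ ∘ φ.symm)) (ContinuousLinearMap.id ℂ ℂ) (φ p) := by
      refine (hasFDerivAt_id _).congr_of_eventuallyEq ?_
      have h5 : ∀ᶠ z in 𝓝 (φ p), φ.symm z ∈ χ.source :=
        (φ.symm.continuousAt (φ.map_source hp)).eventually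
          (by rw [φ.left_inv hp]; exact χ.open_source.mem_nhds hpχ)
      filter_upwards [h5, φ.open_target.mem_nhds (φ.map_source hp)] with z hz hz'
      simp [χ.left_inv hz, φ.right_inv hz']
    exact congrArg (fun L : ℂ →L[ℂ] ℂ => L z) (h3.unique h4)
  · exact (fderiv ℂ (φ ∘ χ.symm) (χ p)).map_smul Complex.I v
  · intro W _ _ f hf v
    have h3 := (differentiableAt_comp_chart_symm hf).hasFDerivAt
    have h4 : DifferentiableAt ℝ (f ∘ φ.symm) (φ p) := by
      have h5 : HasFDerivAt ((f ∘ χ.symm) ∘ (χ ∘ φ.symm)) _ (φ p) :=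
        HasFDerivAt.comp _ (by rw [e2]; exact h3) h2R
      refine h5.differentiableAt.congr_of_eventuallyEq ?_
      have h5 : ∀ᶠ z in 𝓝 (φ p), φ.symm z ∈ χ.source :=
        (φ.symm.continuousAt (φ.map_source hp)).eventually
          (by rw [φ.left_inv hp]; exact χ.open_source.mem_nhds hpχ)
      filter_upwards [h5] with z hz
      simp [χ.left_inv hz]
    have h6 : HasFDerivAt ((f ∘ φ.symm) ∘ (φ ∘ χ.symm)) _ (χ p) :=
      HasFDerivAt.comp _ (by rw [e1]; exact h4.hasFDerivAt) h1R
    have h7 := h6.congr_of_eventuallyEq (f₁ := f ∘ χ.symm) (by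
      have h5 : ∀ᶠ z in 𝓝 (χ p), χ.symm z ∈ φ.source :=
        (χ.symm.continuousAt (χ.map_source hpχ)).eventually
          (by rw [χ.left_inv hpχ]; exact φ.open_source.mem_nhds hp)
      filter_upwards [h5] with z hz
      simp [φ.left_inv hz])
    rw [diff_apply hf]
    exact congrArg (fun L : ℂ →L[ℝ] W => L v) (h3.unique h7)

end Surface

end

end Cayley

/-! ### The forms of an adapted framing along a pseudoholomorphic curve -/

namespace Cayley

open Filter Topology

noncomputable section

section Surface

variable {S : Type*} [TopologicalSpace S] [ChartedSpace ℂ S]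

theorem inner_wedge_apply_orthogonal {u v x : Oct} (hu : ‖u‖ = 1) (hv : ‖v‖ = 1)
    (huv : ⟪u, v⟫_ℝ = 0) (hx : x ∈ (plane (wedge u v))ᗮ) : ⟪u, x⟫_ℝ = 0 ∧ ⟪v, x⟫_ℝ = 0 := by
  have h : ∀ y, ⟪wedge u v y, x⟫_ℝ = 0 := fun y => hx _ ⟨y, rfl⟩
  have h1 := h v
  have h2 := h u
  rw [real_inner_comm] at huv
  simp [wedge, inner_sub_left, inner_smul_left, hu, hv, huv] at h1 h2
  simp [real_inner_comm] at huv
  simp [huv] at h1 h2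
  exact ⟨h1, h2⟩

theorem plane_wedge_le {u v : Oct} {P : Submodule ℝ Oct} (hu : u ∈ P) (hv : v ∈ P) :
    plane (wedge u v) ≤ P := by
  rintro _ ⟨y, rfl⟩
  simp only [wedge, ContinuousLinearMap.coe_coe, sub_apply, ContinuousLinearMap.smulRight_apply]
  exact sub_mem (Submodule.smul_mem _ _ hu) (Submodule.smul_mem _ _ hv)

theorem isOneZero_iff_piZeroOne {p : S} (b : Tan p →L[ℝ] ℂ) : IsOneZero b ↔ piZeroOne b = 0 := by
  constructor
  · intro h
    ext v
    have := h v
    simp only [piZeroOne, smul_apply, add_apply, ContinuousLinearMap.comp_apply, this, smul_eq_mul,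
      zero_apply]
    linear_combination (1 / 2 : ℂ) * b v * Complex.I_mul_I
  · intro h v
    have := congrArg (fun L : Tan p →L[ℝ] ℂ => L v) h
    simp only [piZeroOne, smul_apply, add_apply, ContinuousLinearMap.comp_apply, smul_eq_mul,
      zero_apply] at this
    linear_combination (-2 * Complex.I) * this + b (rot p v) * Complex.I_mul_I

namespace AdaptedFraming

variable {γ : S → Oct →L[ℝ] Oct} {U : TopologicalSpace.Opens S} (e : AdaptedFraming γ U)

/-- The normal coordinates of the differential of a map. -/
def normalDiff (f : S → Oct) (p : S) (v : Tan p) : Fin 3 → ℂ :=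
  normalCoord (e.vec p) (diff f p v)

/-- The connection matrix in the direction of a tangent vector. -/
def connMat (p : S) (v : Tan p) (a b : Fin 8) : ℝ := e.conn a b p v

variable {p : S}

theorem mdiff_vec (hp : p ∈ U) (i : Fin 8) :
    MDifferentiableAt 𝓘(ℝ, ℂ) 𝓘(ℝ, Oct) (fun q => e.vec q i) p :=
  ((e.smooth i).contMDiffAt (U.isOpen.mem_nhds hp)).mdifferentiableAt (by simp)

theorem mdiff_section {s : S → Oct} (hs : s ∈ sectionsH γ U) (hp : p ∈ U) :
    MDifferentiableAt 𝓘(ℝ, ℂ) 𝓘(ℝ, Oct) s p :=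
  (hs.1.contMDiffAt (U.isOpen.mem_nhds hp)).mdifferentiableAt (by simp)

theorem eventually_adapted (hp : p ∈ U) (v : Tan p) :
    ∀ᶠ t in 𝓝 (0 : ℝ), IsAdaptedFrame (e.vec (curve p v t)) :=
  (tendsto_curve p v).eventually
    (Filter.Eventually.mono (U.isOpen.mem_nhds hp) fun q hq => e.adapted q hq)

theorem isSpin_connMat (hp : p ∈ U) (v : Tan p) : IsSpin (e.connMat p v) := by
  have := isSpin_velocity (e.eventually_adapted hp v) fun i => hasDerivAt_curve (e.mdiff_vec hp i) v
  rw [curve_zero] at this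
  exact this

theorem inner_section_eq_zero {s : S → Oct} (hs : s ∈ sectionsH γ U) (hp : p ∈ U) :
    ⟪e.vec p 1, s p⟫_ℝ = 0 ∧ ⟪e.vec p 2, s p⟫_ℝ = 0 := by
  have h := hs.2 p hp
  rw [← e.span p hp] at h
  have ha := e.adapted p hp
  exact inner_wedge_apply_orthogonal (ha.1.1 1) (ha.1.1 2) (by simp [ha.inner_eq]) h

theorem mdiff_comp {s : S → Oct} (hs : s ∈ sectionsH γ U) (hp : p ∈ U) (a : Fin 8) :
    MDifferentiableAt 𝓘(ℝ, ℂ) 𝓘(ℝ, ℝ) (e.comp s a) p :=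
  ((e.contMDiffOn_comp ⟨s, hs⟩ a).contMDiffAt (U.isOpen.mem_nhds hp)).mdifferentiableAt (by simp)

/-- The differential of a coefficient of a section. -/
theorem diff_coef {s : S → Oct} (hs : s ∈ sectionsH γ U) (hp : p ∈ U) (v : Tan p) (i : Fin 3) :
    diff (e.coef s i) p v = cplx (fun a => diff (e.comp s a) p v) i := by
  have h1 := hasDerivAt_cplx fun a => hasDerivAt_curve (e.mdiff_comp hs hp a) v
  have h2 := hasDerivAt_pi.1 h1 i
  have h3 := hasDerivAt_curve (e.mdiff_coef ⟨s, hs⟩ i hp) v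
  exact h3.unique h2

theorem alpha_apply (s : S → Oct) (v : Tan p) (i : Fin 3) :
    e.alpha s i p v = cplx (fun a => diff (e.comp s a) p v
      + ∑ b ∈ ({3, 4, 5, 6, 7, 8} : Finset (Fin 8)), e.comp s b p * e.connMat p v a b) i := by
  have h : ∀ a, e.sPrime s a p v = ((diff (e.comp s a) p v
      + ∑ b ∈ ({3, 4, 5, 6, 7, 8} : Finset (Fin 8)), e.comp s b p * e.connMat p v a b : ℝ) : ℂ) := by
    intro a
    simp only [sPrime, toC, ContinuousLinearMap.comp_apply, add_apply, sum_apply, smul_apply]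
    rfl
  fin_cases i <;>
    simp only [alpha, cplx, ← h] <;> rfl

theorem kappa_apply (v : Tan p) (i j : Fin 3) :
    e.kappa p i j v = kappaMat (e.connMat p v) i j := by
  fin_cases i <;> fin_cases j <;> rfl

theorem bracketThetaBar_apply (v : Tan p) (i j : Fin 3) :
    e.bracketThetaBar p i j v = bracketMat (e.connMat p v) i j := by
  fin_cases i <;> fin_cases j <;> rfl

/-- The forms `α_i` in terms of `κ` and `[θ̄_od]`. -/
theorem alpha_eq {s : S → Oct} (hs : s ∈ sectionsH γ U) (hp : p ∈ U) (i : Fin 3) :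
    e.alpha s i p = diff (e.coef s i) p + ∑ j, e.coef s j p • e.kappa p i j
      + (Complex.I / 2) • ∑ j, (starRingEnd ℂ) (e.coef s j p) • e.bracketThetaBar p i j := by
  ext v
  rw [e.alpha_apply, cplx_add, Pi.add_apply, (e.isSpin_connMat hp v).cplx_sum, ← e.diff_coef hs hp]
  simp only [add_apply, smul_apply, sum_apply, smul_eq_mul, kappa_apply, bracketThetaBar_apply]
  rw [add_assoc]
  rfl

/-- The forms `α_i` are the normal coordinates of `ds`. -/
theorem normalDiff_section {s : S → Oct} (hs : s ∈ sectionsH γ U) (hp : p ∈ U) (v : Tan p)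
    (i : Fin 3) : e.normalDiff s p v i = e.alpha s i p v := by
  rw [e.alpha_apply, normalDiff, normalCoord]
  congr 1
  funext a
  have h1 := inner_deriv_eq (e.eventually_adapted hp v)
    (fun i => hasDerivAt_curve (e.mdiff_vec hp i) v) (hasDerivAt_curve (mdiff_section hs hp) v) a
  have h2 := h1.unique (hasDerivAt_curve (e.mdiff_comp hs hp a) v)
  rw [curve_zero] at h2
  -- The section is normal to the plane, so the terms with labels `1` and `2` vanish and the sum
  -- becomes the one in `s'^a`.
  have h3 : (Finset.univ : Finset (Fin 8)) = insert 1 (insert 2 {3, 4, 5, 6, 7, 8}) := by decide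
  rw [h3, Finset.sum_insert (by decide), Finset.sum_insert (by decide),
    (e.inner_section_eq_zero hs hp).1, (e.inner_section_eq_zero hs hp).2] at h2
  rw [← h2, zero_mul, zero_mul, zero_add, zero_add, sub_eq_iff_eq_add.symm]
  rfl

/-- Differentiate `γ = e₁ ∧ e₂` along a curve, evaluate at `e₂` or `e₁` and pair with `e_j`: for `j
≠ 1, 2` only `ω_{j1}` or `-ω_{j2}` is left. -/
theorem grOne_apply (hγ : MDifferentiableAt 𝓘(ℝ, ℂ) 𝓘(ℝ, Oct →L[ℝ] Oct) γ p) (hp : p ∈ U)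
    (v : Tan p) {j : Fin 8} (h1 : j ≠ 1) (h2 : j ≠ 2) :
    grOne γ (e.vec p) j p v = e.connMat p v j 1 ∧ grTwo γ (e.vec p) j p v = e.connMat p v j 2 := by
  have ha := e.adapted p hp
  have hd : ∀ x : Oct, diff γ p v x = (⟪e.vec p 2, x⟫_ℝ • diff (fun q => e.vec q 1) p v
      + ⟪diff (fun q => e.vec q 2) p v, x⟫_ℝ • e.vec p 1)
      - (⟪e.vec p 1, x⟫_ℝ • diff (fun q => e.vec q 2) p v
      + ⟪diff (fun q => e.vec q 1) p v, x⟫_ℝ • e.vec p 2) := by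
    intro x
    have d1 := hasDerivAt_curve (e.mdiff_vec hp 1) v
    have d2 := hasDerivAt_curve (e.mdiff_vec hp 2) v
    have d3 := ((d2.inner ℝ (hasDerivAt_const 0 x)).smul d1).sub
      ((d1.inner ℝ (hasDerivAt_const 0 x)).smul d2)
    simp only [curve_zero, inner_zero_right, zero_add] at d3
    have d4 : HasDerivAt (fun t => γ (curve p v t) x) (diff γ p v x) 0 :=
      (ContinuousLinearMap.apply ℝ Oct x).hasFDerivAt.comp_hasDerivAt 0 (hasDerivAt_curve hγ v)
    refine d4.unique (d3.congr_of_eventuallyEq ?_)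
    filter_upwards [(tendsto_curve p v).eventually (U.isOpen.mem_nhds hp)] with t ht
    rw [← e.span _ ht]
    rfl
  constructor
  · change ⟪e.vec p j, diff γ p v (e.vec p 2)⟫_ℝ = ⟪e.vec p j, diff (fun q => e.vec q 1) p v⟫_ℝ
    rw [hd]
    simp [inner_add_right, inner_sub_right, inner_smul_right, ha.inner_eq, ha.1.1, h1, h2]
  · change -⟪e.vec p j, diff γ p v (e.vec p 1)⟫_ℝ = ⟪e.vec p j, diff (fun q => e.vec q 2) p v⟫_ℝ
    rw [hd]
    simp [inner_add_right, inner_sub_right, inner_smul_right, ha.inner_eq, ha.1.1, h1, h2]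

/-- Along a pseudoholomorphic curve the normal parts of `de₁` and `de₂` are of type `(1,0)`. -/
theorem normalDiff_vec_rot (hγ : IsPseudoholomorphic γ) (hp : p ∈ U) (v : Tan p) {k : Fin 8}
    (hk : k ∈ ({1, 2} : Finset (Fin 8))) :
    e.normalDiff (fun q => e.vec q k) p (rot p v)
      = Complex.I • e.normalDiff (fun q => e.vec q k) p v := by
  have hd : MDifferentiableAt 𝓘(ℝ, ℂ) 𝓘(ℝ, Oct →L[ℝ] Oct) γ p :=
    (hγ.1 p).mdifferentiableAt (by simp)
  obtain ⟨h1, h2, h3, h4, h5, h6⟩ := hγ.2.2 p (e.vec p) (e.adapted p hp) (e.span p hp)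
  have g1 : ∀ v : Tan p, ∀ j : Fin 8, j ≠ 1 → j ≠ 2 →
      toC (grOne γ (e.vec p) j p) v = (e.connMat p v j 1 : ℂ) := fun v j hj1 hj2 => by
    rw [← (e.grOne_apply hd hp v hj1 hj2).1]; rfl
  have g2 : ∀ v : Tan p, ∀ j : Fin 8, j ≠ 1 → j ≠ 2 →
      toC (grTwo γ (e.vec p) j p) v = (e.connMat p v j 2 : ℂ) := fun v j hj1 hj2 => by
    rw [← (e.grOne_apply hd hp v hj1 hj2).2]; rfl
  have k1 := h1 v
  have k2 := h2 v
  have k3 := h3 v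
  have k4 := h4 v
  have k5 := h5 v
  have k6 := h6 v
  simp only [add_apply, sub_apply, smul_apply, smul_eq_mul] at k1 k2 k3 k4 k5 k6
  rw [g1 _ 3 (by decide) (by decide), g1 _ 4 (by decide) (by decide),
    g1 _ 3 (by decide) (by decide), g1 _ 4 (by decide) (by decide)] at k1
  rw [g1 _ 6 (by decide) (by decide), g1 _ 7 (by decide) (by decide),
    g1 _ 6 (by decide) (by decide), g1 _ 7 (by decide) (by decide)] at k2
  rw [g1 _ 5 (by decide) (by decide), g1 _ 8 (by decide) (by decide),
    g1 _ 5 (by decide) (by decide), g1 _ 8 (by decide) (by decide)] at k3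
  rw [g2 _ 3 (by decide) (by decide), g2 _ 4 (by decide) (by decide),
    g2 _ 3 (by decide) (by decide), g2 _ 4 (by decide) (by decide)] at k4
  rw [g2 _ 6 (by decide) (by decide), g2 _ 7 (by decide) (by decide),
    g2 _ 6 (by decide) (by decide), g2 _ 7 (by decide) (by decide)] at k5
  rw [g2 _ 5 (by decide) (by decide), g2 _ 8 (by decide) (by decide),
    g2 _ 5 (by decide) (by decide), g2 _ 8 (by decide) (by decide)] at k6
  simp only [Finset.mem_insert, Finset.mem_singleton] at hk
  ext i
  rcases hk with rfl | rfl <;> fin_cases i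
  · exact k1
  · exact k2
  · exact k3
  · exact k4
  · exact k5
  · exact k6

end AdaptedFraming

end Surface

end

end Cayley

/-! ### The differential of the ruled map -/

namespace Cayley

open Filter Topology

noncomputable section

section Surface

variable {S : Type*} [TopologicalSpace S] [ChartedSpace ℂ S]

/-- The pull-back of `f` to `ℝ⁴` along `y` is `f y` times the determinant. -/
theorem alternating_eq_zero_of_combination {f : Oct [⋀^Fin 4]→ₗ[ℝ] ℝ} {y x : Fin 4 → Oct}
    (hy : f y = 0) {c : Fin 4 → Fin 4 → ℝ} (hx : ∀ i, x i = ∑ j, c i j • y j) : f x = 0 := by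
  have h := (f.compLinearMap (Fintype.linearCombination ℝ y)).eq_smul_basis_det
    (Pi.basisFun ℝ (Fin 4))
  have h1 := congrArg (fun g : (Fin 4 → ℝ) [⋀^Fin 4]→ₗ[ℝ] ℝ => g c) h
  have h2 : (fun i => Fintype.linearCombination ℝ y (Pi.basisFun ℝ (Fin 4) i)) = y := by
    funext i
    simp [Fintype.linearCombination_apply_single]
  have h3 : (fun i => Fintype.linearCombination ℝ y (c i)) = x := by
    funext i
    rw [hx, Fintype.linearCombination_apply]
  simp only [AlternatingMap.smul_apply, AlternatingMap.compLinearMap_apply, smul_eq_mul] at h1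
  rw [h2, h3, hy, zero_mul] at h1
  exact h1

/-- The tangent vector at `p` with coordinate `1` in the chart at `p`. -/
def unitTan (p : S) : Tan p := (1 : ℂ)

/-- The coordinate of a tangent vector in the chart at `p`. -/
def tanCoord {p : S} (v : Tan p) : ℂ := v

theorem tan_eq {p : S} (v : Tan p) :
    v = (tanCoord v).re • unitTan p + (tanCoord v).im • rot p (unitTan p) := by
  have h : ∀ z : ℂ, z = z.re • (1 : ℂ) + z.im • (Complex.I * 1) := fun z => by simp
  exact h (tanCoord v)

/-- A real-linear map of a tangent space of a Riemann surface that commutes with the complex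
structures is multiplication. -/
theorem eq_smul_of_rot {p : S} {A : Tan p → Fin 3 → ℂ} (hadd : ∀ u v, A (u + v) = A u + A v)
    (hsmul : ∀ (r : ℝ) v, A (r • v) = (r : ℂ) • A v)
    (hrot : ∀ v, A (rot p v) = Complex.I • A v) (u : Tan p) :
    A u = tanCoord u • A (unitTan p) := by
  conv_lhs => rw [tan_eq u]
  rw [hadd, hsmul, hsmul, hrot, smul_smul, ← add_smul, Complex.re_add_im]

theorem normalCoord_add (F : Fin 8 → Oct) (X Y : Oct) :
    normalCoord F (X + Y) = normalCoord F X + normalCoord F Y := by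
  simp only [normalCoord, inner_add_right, ← cplx_add]

theorem normalCoord_smul (F : Fin 8 → Oct) (r : ℝ) (X : Oct) :
    normalCoord F (r • X) = (r : ℂ) • normalCoord F X := by
  simp only [normalCoord, inner_smul_right, ← cplx_smul]

namespace AdaptedFraming

variable {γ : S → Oct →L[ℝ] Oct} {U : TopologicalSpace.Opens S} (e : AdaptedFraming γ U) {p : S}

theorem normalDiff_add (f : S → Oct) (u v : Tan p) :
    e.normalDiff f p (u + v) = e.normalDiff f p u + e.normalDiff f p v := by
  rw [normalDiff, map_add, normalCoord_add]; rfl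

theorem normalDiff_smul (f : S → Oct) (r : ℝ) (v : Tan p) :
    e.normalDiff f p (r • v) = (r : ℂ) • e.normalDiff f p v := by
  rw [normalDiff, map_smul, normalCoord_smul]; rfl

/-- The differential of the part of the 2-ruled 4-fold transverse to the rulings. -/
def transverse (s : S → Oct) (r₁ r₂ : ℝ) (p : S) (v : Tan p) : Oct :=
  r₁ • diff (fun q => e.vec q 1) p v + r₂ • diff (fun q => e.vec q 2) p v + diff s p v

theorem mfderiv_ruled {s : S → Oct} (hs : s ∈ sectionsH γ U) (r₁ r₂ : ℝ) (hp : p ∈ U)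
    (a b : ℝ) (v : Tan p) :
    (mfderiv (𝓘(ℝ, ℝ).prod (𝓘(ℝ, ℝ).prod 𝓘(ℝ, ℂ))) 𝓘(ℝ, Oct) (e.ruled s) (r₁, r₂, p)
        ((a, b, v) : ℝ × ℝ × ℂ) : Oct)
      = a • e.vec p 1 + b • e.vec p 2 + e.transverse s r₁ r₂ p v := by
  set χ := chartAt ℂ p
  have hl : ∀ {f : S → Oct}, MDifferentiableAt 𝓘(ℝ, ℂ) 𝓘(ℝ, Oct) f p →
      HasFDerivAt (fun x : ℝ × ℝ × ℂ => (f ∘ χ.symm) x.2.2)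
        ((fderiv ℝ (f ∘ χ.symm) (χ p)).comp ((ContinuousLinearMap.snd ℝ ℝ ℂ).comp
          (ContinuousLinearMap.snd ℝ ℝ (ℝ × ℂ)))) (r₁, r₂, χ p) := fun hf =>
    HasFDerivAt.comp (r₁, r₂, χ p) (differentiableAt_comp_chart_symm hf).hasFDerivAt
      ((ContinuousLinearMap.snd ℝ ℝ ℂ).comp (ContinuousLinearMap.snd ℝ ℝ (ℝ × ℂ))).hasFDerivAt
  have hx : HasFDerivAt (fun x : ℝ × ℝ × ℂ => x.1) (ContinuousLinearMap.fst ℝ ℝ (ℝ × ℂ))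
      (r₁, r₂, χ p) := hasFDerivAt_fst
  have hy : HasFDerivAt (fun x : ℝ × ℝ × ℂ => x.2.1) ((ContinuousLinearMap.fst ℝ ℝ ℂ).comp
      (ContinuousLinearMap.snd ℝ ℝ (ℝ × ℂ))) (r₁, r₂, χ p) :=
    ((ContinuousLinearMap.fst ℝ ℝ ℂ).comp (ContinuousLinearMap.snd ℝ ℝ (ℝ × ℂ))).hasFDerivAt
  have h1 := hl (e.mdiff_vec hp 1)
  have h2 := hl (e.mdiff_vec hp 2)
  have h3 := hl (mdiff_section hs hp)
  have h4 := ((hx.smul h1).add (hy.smul h2)).add h3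
  have hcont : ContinuousAt (e.ruled s) (r₁, r₂, p) := by
    have ht : Tendsto (fun q : ℝ × ℝ × S => q.2.2) (𝓝 (r₁, r₂, p)) (𝓝 p) :=
      (continuous_snd.comp continuous_snd).continuousAt
    have c1 : ContinuousAt (fun q : ℝ × ℝ × S => e.vec q.2.2 1) (r₁, r₂, p) :=
      (e.mdiff_vec hp 1).continuousAt.tendsto.comp ht
    have c2 : ContinuousAt (fun q : ℝ × ℝ × S => e.vec q.2.2 2) (r₁, r₂, p) :=
      (e.mdiff_vec hp 2).continuousAt.tendsto.comp ht
    have c3 : ContinuousAt (fun q : ℝ × ℝ × S => s q.2.2) (r₁, r₂, p) :=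
      (mdiff_section hs hp).continuousAt.tendsto.comp ht
    exact ((continuousAt_fst.smul c1).add
      ((continuous_fst.comp continuous_snd).continuousAt.smul c2)).add c3
  -- In the product chart at this point the real factors are unchanged and the last one is read
  -- through `χ`, so `h4` is the derivative in charts.
  have h5 : HasMFDerivAt (𝓘(ℝ, ℝ).prod (𝓘(ℝ, ℝ).prod 𝓘(ℝ, ℂ))) 𝓘(ℝ, Oct) (e.ruled s) (r₁, r₂, p) _ :=
    ⟨hcont, h4.hasFDerivWithinAt⟩
  have h6 := congrArg (fun L : (TangentSpace (𝓘(ℝ, ℝ).prod (𝓘(ℝ, ℝ).prod 𝓘(ℝ, ℂ))) ((r₁, r₂, p) : ℝ × ℝ × S) →L[ℝ]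
    TangentSpace 𝓘(ℝ, Oct) (e.ruled s (r₁, r₂, p))) => L ((a, b, v) : ℝ × ℝ × ℂ)) h5.mfderiv
  rw [transverse, diff_apply (e.mdiff_vec hp 1), diff_apply (e.mdiff_vec hp 2),
    diff_apply (mdiff_section hs hp)]
  have h7 : χ.symm (χ p) = p := χ.left_inv (mem_chart_source ℂ p)
  have h8 : ∀ X₁ X₂ X₃ Y₁ Y₂ : Oct, r₁ • X₁ + a • Y₁ + (r₂ • X₂ + b • Y₂) + X₃
      = a • Y₁ + b • Y₂ + (r₁ • X₁ + r₂ • X₂ + X₃) := fun _ _ _ _ _ => by abel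
  have h9 := h8 (fderiv ℝ ((fun q => e.vec q 1) ∘ χ.symm) (χ p) v)
    (fderiv ℝ ((fun q => e.vec q 2) ∘ χ.symm) (χ p) v) (fderiv ℝ (s ∘ χ.symm) (χ p) v)
    (e.vec (χ.symm (χ p)) 1) (e.vec (χ.symm (χ p)) 2)
  refine h6.trans (Eq.trans h9 ?_)
  rw [h7]

end AdaptedFraming

end Surface

end

end Cayley

/-! ### The Cayley condition, the reduced equations and type `(1,0)` -/

namespace Cayley

open Filter Topology

noncomputable section

section Surface

variable {S : Type*} [TopologicalSpace S] [ChartedSpace ℂ S]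

namespace AdaptedFraming

variable {γ : S → Oct →L[ℝ] Oct} {U : TopologicalSpace.Opens S} (e : AdaptedFraming γ U) {p : S}

theorem transverse_add (s : S → Oct) (r₁ r₂ : ℝ) (u v : Tan p) :
    e.transverse s r₁ r₂ p (u + v) = e.transverse s r₁ r₂ p u + e.transverse s r₁ r₂ p v := by
  simp only [transverse, map_add, smul_add]; abel

theorem transverse_smul (s : S → Oct) (r₁ r₂ c : ℝ) (v : Tan p) :
    e.transverse s r₁ r₂ p (c • v) = c • e.transverse s r₁ r₂ p v := by
  simp only [transverse, map_smul, smul_add, smul_comm c]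

/-- The two derivatives along the rulings are `e₁` and `e₂`. Conversely, the differential has its
image in the span of four vectors, so one evaluation of each `ψ_m` decides its pull-back. -/
theorem isCayley_iff_transverse {s : S → Oct} (hs : s ∈ sectionsH γ U) :
    e.IsCayley s ↔ ∀ p ∈ U, ∀ (r₁ r₂ : ℝ) (u v : Tan p) (m : Fin 7),
      psi m (e.vec p 1) (e.vec p 2) (e.transverse s r₁ r₂ p u) (e.transverse s r₁ r₂ p v) = 0 := by
  constructor
  · intro h p hp r₁ r₂ u v m
    have h1 := h (r₁, r₂, p) hp m ![((1, 0, (0 : ℂ)) : ℝ × ℝ × ℂ), ((0, 1, (0 : ℂ)) : ℝ × ℝ × ℂ),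
      ((0, 0, u) : ℝ × ℝ × ℂ), ((0, 0, v) : ℝ × ℝ × ℂ)]
    have h0 : e.transverse s r₁ r₂ p (0 : Tan p) = 0 := by simp [transverse]
    have k1 := e.mfderiv_ruled hs r₁ r₂ hp 1 0 (0 : Tan p)
    have k2 := e.mfderiv_ruled hs r₁ r₂ hp 0 1 (0 : Tan p)
    have k3 := e.mfderiv_ruled hs r₁ r₂ hp 0 0 u
    have k4 := e.mfderiv_ruled hs r₁ r₂ hp 0 0 v
    rw [h0] at k1 k2
    simp only [one_smul, zero_smul, add_zero, zero_add] at k1 k2 k3 k4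
    rw [← k1, ← k2, ← k3, ← k4]
    exact h1
  · rintro h ⟨r₁, r₂, p⟩ hp m x D
    let y : Fin 4 → Oct := ![e.vec p 1, e.vec p 2, e.transverse s r₁ r₂ p (unitTan p),
      e.transverse s r₁ r₂ p (rot p (unitTan p))]
    let x' : Fin 4 → ℝ × ℝ × ℂ := x
    let c : Fin 4 → Fin 4 → ℝ := fun i => ![(x' i).1, (x' i).2.1, ((x' i).2.2).re, ((x' i).2.2).im]
    have hy : psiAlt m y = 0 := by
      rw [psiAlt_apply]
      exact h p hp r₁ r₂ (unitTan p) (rot p (unitTan p)) m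
    have hx : ∀ i, D (x i) = ∑ j, c i j • y j := by
      intro i
      have k := e.mfderiv_ruled hs r₁ r₂ hp (x' i).1 (x' i).2.1 ((x' i).2.2 : ℂ)
      refine k.trans ?_
      have k2 : e.transverse s r₁ r₂ p ((x' i).2.2 : ℂ)
          = ((x' i).2.2).re • e.transverse s r₁ r₂ p (unitTan p)
            + ((x' i).2.2).im • e.transverse s r₁ r₂ p (rot p (unitTan p)) := by
        have k3 := congrArg (e.transverse s r₁ r₂ p) (tan_eq (p := p) ((x' i).2.2 : ℂ))
        rw [transverse_add, transverse_smul, transverse_smul] at k3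
        exact k3
      rw [k2, Fin.sum_univ_four]
      simp only [c, y, Matrix.cons_val]
      abel
    have := alternating_eq_zero_of_combination (x := fun i => D (x i)) hy hx
    rwa [psiAlt_apply] at this

theorem normalCoord_transverse (s : S → Oct) (r₁ r₂ : ℝ) (v : Tan p) :
    normalCoord (e.vec p) (e.transverse s r₁ r₂ p v)
      = (r₁ : ℂ) • e.normalDiff (fun q => e.vec q 1) p v
        + (r₂ : ℂ) • e.normalDiff (fun q => e.vec q 2) p v + e.normalDiff s p v := by
  simp only [transverse, normalCoord_add, normalCoord_smul]
  rfl

/-- The reduced equations in normal coordinates. -/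
def CrossEquations (s : S → Oct) : Prop :=
  ∀ p ∈ U, ∀ u v : Tan p,
    crossProduct (e.normalDiff s p u) (e.normalDiff s p v) = 0 ∧
    ∀ k ∈ ({1, 2} : Finset (Fin 8)),
      crossProduct (e.normalDiff (fun q => e.vec q k) p u) (e.normalDiff s p v)
        - crossProduct (e.normalDiff (fun q => e.vec q k) p v) (e.normalDiff s p u) = 0

/-- The real-linear maps of `exists_psi_cross` are the same for all pairs of vectors, so they carry
the differences of values as well. -/
theorem reducedEquations_iff (s : S → Oct) : e.ReducedEquations s ↔ e.CrossEquations s := by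
  constructor
  · intro h p hp u v
    obtain ⟨T, T', hT⟩ := (e.adapted p hp).exists_psi_cross
    refine ⟨?_, fun k hk => ?_⟩
    · refine (hT _ _).2.trans ?_
      rw [show (fun m => psi m (e.vec p 1) (e.vec p 2) (diff s p u) (diff s p v)) = 0 from
        funext fun m => (h p hp m u v).1, map_zero]
    · simp only [normalDiff]
      rw [(hT _ _).2, (hT (diff (fun q => e.vec q k) p v) _).2, ← map_sub]
      rw [show (fun m => psi m (e.vec p 1) (e.vec p 2) (diff (fun q => e.vec q k) p u) (diff s p v))
        - (fun m => psi m (e.vec p 1) (e.vec p 2) (diff (fun q => e.vec q k) p v) (diff s p u)) = 0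
        from funext fun m => (h p hp m u v).2 k hk, map_zero]
  · intro h p hp m u v
    obtain ⟨T, T', hT⟩ := (e.adapted p hp).exists_psi_cross
    have h1 := h p hp u v
    simp only [normalDiff] at h1
    refine ⟨?_, fun k hk => ?_⟩
    · have h2 := congrFun (hT (diff s p u) (diff s p v)).1 m
      rw [h1.1, map_zero] at h2
      exact h2
    · have h2 := congrFun (hT (diff (fun q => e.vec q k) p u) (diff s p v)).1 m
      have h3 := congrFun (hT (diff (fun q => e.vec q k) p v) (diff s p u)).1 m
      rw [h2, h3, ← Pi.sub_apply, ← map_sub, h1.2 k hk, map_zero]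
      rfl

/-- A complex-linear map on a complex line: this is where the dimension of the surface enters. -/
theorem normalDiff_vec (hγ : IsPseudoholomorphic γ) (hp : p ∈ U) {k : Fin 8}
    (hk : k ∈ ({1, 2} : Finset (Fin 8))) (v : Tan p) :
    e.normalDiff (fun q => e.vec q k) p v
      = tanCoord v • e.normalDiff (fun q => e.vec q k) p (unitTan p) :=
  eq_smul_of_rot (A := e.normalDiff (fun q => e.vec q k) p) (fun u v => e.normalDiff_add _ u v)
    (fun r v => e.normalDiff_smul _ r v) (fun v => e.normalDiff_vec_rot hγ hp v hk) v

/-- The pull-back of the `ψ_m` is a polynomial in `r₁`, `r₂` whose quadratic terms vanish. -/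
theorem isCayley_iff_crossEquations (hγ : IsPseudoholomorphic γ) {s : S → Oct}
    (hs : s ∈ sectionsH γ U) : e.IsCayley s ↔ e.CrossEquations s := by
  have hI1 : (1 : Fin 8) ∈ ({1, 2} : Finset (Fin 8)) := by decide
  have hI2 : (2 : Fin 8) ∈ ({1, 2} : Finset (Fin 8)) := by decide
  have key : ∀ p ∈ U, ∀ (r₁ r₂ : ℝ) (u v : Tan p),
      crossProduct (normalCoord (e.vec p) (e.transverse s r₁ r₂ p u))
        (normalCoord (e.vec p) (e.transverse s r₁ r₂ p v))
      = crossProduct (e.normalDiff s p u) (e.normalDiff s p v)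
        + (r₁ : ℂ) • (crossProduct (e.normalDiff (fun q => e.vec q 1) p u) (e.normalDiff s p v)
          - crossProduct (e.normalDiff (fun q => e.vec q 1) p v) (e.normalDiff s p u))
        + (r₂ : ℂ) • (crossProduct (e.normalDiff (fun q => e.vec q 2) p u) (e.normalDiff s p v)
          - crossProduct (e.normalDiff (fun q => e.vec q 2) p v) (e.normalDiff s p u)) := by
    intro p hp r₁ r₂ u v
    -- With `z_k(u) = u z_k`, the coefficient of `r_k r_l` is a multiple of `z_k × z_l + z_l × z_k`,
    -- which is zero.
    rw [normalCoord_transverse, normalCoord_transverse, e.normalDiff_vec hγ hp hI1 u,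
      e.normalDiff_vec hγ hp hI1 v, e.normalDiff_vec hγ hp hI2 u, e.normalDiff_vec hγ hp hI2 v]
    ext i
    fin_cases i <;>
    · simp [cross_apply]
      ring
  rw [e.isCayley_iff_transverse hs]
  constructor
  · intro h p hp u v
    obtain ⟨T, T', hT⟩ := (e.adapted p hp).exists_psi_cross
    have h1 : ∀ r₁ r₂, crossProduct (normalCoord (e.vec p) (e.transverse s r₁ r₂ p u))
        (normalCoord (e.vec p) (e.transverse s r₁ r₂ p v)) = 0 := fun r₁ r₂ => by
      rw [(hT _ _).2, show (fun m => psi m (e.vec p 1) (e.vec p 2) (e.transverse s r₁ r₂ p u)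
        (e.transverse s r₁ r₂ p v)) = 0 from funext fun m => h p hp r₁ r₂ u v m, map_zero]
    -- What remains is affine in `(r₁, r₂)`, so three values determine its coefficients.
    have h00 := h1 0 0
    have h10 := h1 1 0
    have h01 := h1 0 1
    rw [key p hp] at h00 h10 h01
    simp only [Complex.ofReal_zero, zero_smul, add_zero] at h00
    rw [h00] at h10 h01
    simp only [Complex.ofReal_zero, Complex.ofReal_one, zero_smul, one_smul, add_zero,
      zero_add] at h10 h01
    refine ⟨h00, fun k hk => ?_⟩
    simp only [Finset.mem_insert, Finset.mem_singleton] at hk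
    rcases hk with rfl | rfl
    · exact h10
    · exact h01
  · intro h p hp r₁ r₂ u v m
    obtain ⟨T, T', hT⟩ := (e.adapted p hp).exists_psi_cross
    have h2 := congrFun (hT (e.transverse s r₁ r₂ p u) (e.transverse s r₁ r₂ p v)).1 m
    rw [key p hp, (h p hp u v).1, (h p hp u v).2 1 hI1, (h p hp u v).2 2 hI2] at h2
    simpa using h2

theorem isOneZero_alpha_iff {s : S → Oct} (hs : s ∈ sectionsH γ U) (hp : p ∈ U) :
    (∀ i, IsOneZero (e.alpha s i p)) ↔
      ∀ v : Tan p, e.normalDiff s p (rot p v) = Complex.I • e.normalDiff s p v := by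
  constructor
  · intro h v
    ext i
    simp only [Pi.smul_apply, smul_eq_mul, e.normalDiff_section hs hp]
    exact h i v
  · intro h i v
    have := congrFun (h v) i
    simpa only [Pi.smul_apply, smul_eq_mul, e.normalDiff_section hs hp] using this

/-- All the forms involved are a tangent coordinate times a fixed vector, so the first product is a
multiple of `A × A` and the mixed one is symmetric in `u, v`. Flatness plays no role in this
direction. -/
theorem crossEquations_of_rot (hγ : IsPseudoholomorphic γ) {s : S → Oct}
    (h : ∀ p ∈ U, ∀ v : Tan p, e.normalDiff s p (rot p v) = Complex.I • e.normalDiff s p v) :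
    e.CrossEquations s := by
  intro p hp u v
  have hA := eq_smul_of_rot (A := e.normalDiff s p) (fun u v => e.normalDiff_add _ u v)
    (fun r v => e.normalDiff_smul _ r v) (h p hp)
  refine ⟨?_, fun k hk => ?_⟩
  · rw [hA u, hA v]
    simp [cross_self]
  · rw [hA u, hA v, e.normalDiff_vec hγ hp hk u, e.normalDiff_vec hγ hp hk v]
    ext i
    fin_cases i <;>
    · simp [cross_apply]
      ring

/-- Over a curve whose asymptotic cone is nowhere flat the reduced equations force the normal part
of `ds` to be of type `(1,0)`. -/
theorem rot_of_crossEquations [IsManifold 𝓘(ℂ) ω S] (hγ : IsPseudoholomorphic γ)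
    (hflat : ∀ V : Set S, V ⊆ U → IsOpen V → V.Nonempty → ¬ IsFlatOn γ V) {s : S → Oct}
    (hs : s ∈ sectionsH γ U) (h : e.CrossEquations s) :
    ∀ p ∈ U, ∀ v : Tan p, e.normalDiff s p (rot p v) = Complex.I • e.normalDiff s p v := by
  by_contra! hcon
  obtain ⟨p₀, hp₀, v₀, hv₀⟩ := hcon
  have : IsManifold 𝓘(ℝ, ℂ) ∞ S := isManifold_real
  set φ := chartAt ℂ p₀ with hφ
  let Ω₀ : Set ℂ := φ.target ∩ φ.symm ⁻¹' (U : Set S)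
  have hΩ₀ : IsOpen Ω₀ := φ.symm.isOpen_inter_preimage U.isOpen
  have hsm : ∀ {f : S → Oct}, ContMDiffOn 𝓘(ℝ, ℂ) 𝓘(ℝ, Oct) ∞ f U →
      ContDiffOn ℝ ∞ (f ∘ φ.symm) Ω₀ := by
    intro f hf
    rw [← contMDiffOn_iff_contDiffOn]
    exact hf.comp (contMDiffOn_chart_symm.mono Set.inter_subset_left) fun q hq => hq.2
  let ê : ℂ → Fin 8 → Oct := fun q => e.vec (φ.symm q)
  let ŝ : ℂ → Oct := s ∘ φ.symm
  have hê : ∀ i, ContDiffOn ℝ ∞ (fun q => ê q i) Ω₀ := fun i => hsm (e.smooth i)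
  have hŝ : ContDiffOn ℝ ∞ ŝ Ω₀ := hsm hs.1
  let B : ℂ → Fin 3 → ℂ := fun q => normalCoord (ê q) (fderiv ℝ ŝ q Complex.I)
    - Complex.I • normalCoord (ê q) (fderiv ℝ ŝ q 1)
  have hBc : ContinuousOn B Ω₀ := by
    have hD : ∀ u, ContDiffOn ℝ ∞ (fun q => fderiv ℝ ŝ q u) Ω₀ := fun u =>
      (hŝ.fderiv_of_isOpen hΩ₀ (by simp)).clm_apply contDiffOn_const
    exact ((contDiffOn_normalCoord hê (hD _)).sub
      ((contDiffOn_normalCoord hê (hD _)).const_smul Complex.I)).continuousOn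
  -- `B` measures the failure of the normal part of `ds` to be complex linear. Its nonvanishing set
  -- is open, and the assumed counterexample lies in it.
  let Ω : Set ℂ := Ω₀ ∩ B ⁻¹' {0}ᶜ
  have hΩ : IsOpen Ω := hBc.isOpen_inter_preimage hΩ₀ isOpen_compl_singleton
  have htr : ∀ q ∈ Ω₀, ∃ v₁ : Tan (φ.symm q), ∀ {f : S → Oct},
      MDifferentiableAt 𝓘(ℝ, ℂ) 𝓘(ℝ, Oct) f (φ.symm q) →
      fderiv ℝ (f ∘ φ.symm) q 1 = diff f (φ.symm q) v₁ ∧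
      fderiv ℝ (f ∘ φ.symm) q Complex.I = diff f (φ.symm q) (rot (φ.symm q) v₁) := by
    intro q hq
    obtain ⟨T, hT, hTr, hTf⟩ := exists_chart_transfer (φ.map_target hq.1)
    obtain ⟨v₁, hv₁⟩ := hT 1
    refine ⟨v₁, fun hf => ?_⟩
    rw [hTf hf, hTf hf, hTr, hv₁, mul_one, φ.right_inv hq.1]
    exact ⟨rfl, rfl⟩
  have hne : Ω.Nonempty := by
    refine ⟨φ p₀, ⟨mem_chart_target ℂ p₀, ?_⟩, ?_⟩
    · change φ.symm (φ p₀) ∈ U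
      rwa [φ.left_inv (mem_chart_source ℂ p₀)]
    · intro hB
      obtain ⟨T, hT, hTr, hTf⟩ := exists_chart_transfer (mem_chart_source ℂ p₀)
      have hB' : normalCoord (e.vec p₀) (fderiv ℝ ŝ (φ p₀) Complex.I)
          = Complex.I • normalCoord (e.vec p₀) (fderiv ℝ ŝ (φ p₀) 1) := by
        have h1 : φ.symm (φ p₀) = p₀ := φ.left_inv (mem_chart_source ℂ p₀)
        have h2 := sub_eq_zero.1 (Set.mem_singleton_iff.1 hB)
        simp only [ê, h1] at h2
        exact h2
      have hds := hTf (mdiff_section hs hp₀)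
      refine hv₀ ?_
      simp only [normalDiff]
      rw [hds, hds, hTr]
      change normalCoord (e.vec p₀) (fderiv ℝ ŝ (φ p₀) _)
        = Complex.I • normalCoord (e.vec p₀) (fderiv ℝ ŝ (φ p₀) _)
      -- Complex linearity on the real basis `1, i` gives it on every vector.
      rw [fderiv_apply_eq ŝ _ (Complex.I * T v₀), fderiv_apply_eq ŝ _ (T v₀)]
      simp only [normalCoord_add, normalCoord_smul, hB']
      simp only [Complex.I_mul_re, Complex.I_mul_im, Complex.ofReal_neg]
      ext i
      simp only [Pi.add_apply, Pi.smul_apply, smul_eq_mul]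
      linear_combination (-((T v₀).im : ℂ)) * normalCoord (e.vec p₀) (fderiv ℝ ŝ (φ p₀) 1) i
        * Complex.I_mul_I
  have hcr : ∀ q ∈ Ω, crossProduct (normalCoord (ê q) (fderiv ℝ ŝ q 1)) (B q) = 0 ∧
      ∀ k ∈ ({1, 2} : Finset (Fin 8)),
        normalCoord (ê q) (fderiv ℝ (fun p => ê p k) q Complex.I)
          = Complex.I • normalCoord (ê q) (fderiv ℝ (fun p => ê p k) q 1) ∧
        crossProduct (normalCoord (ê q) (fderiv ℝ (fun p => ê p k) q 1)) (B q) = 0 := by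
    intro q hq
    obtain ⟨v₁, hv₁⟩ := htr q hq.1
    have hqU : φ.symm q ∈ U := hq.1.2
    obtain ⟨c1, c2⟩ := h _ hqU v₁ (rot _ v₁)
    -- The reduced equations for the pair `v₁, rot v₁`, that is, for `1, i` in the chart at `p₀`.
    -- Complex linearity of `z_k` turns the mixed one into `z_k × B = 0`.
    obtain ⟨s1, s2⟩ := hv₁ (mdiff_section hs hqU)
    simp only [normalDiff] at c1 c2
    rw [← s1, ← s2] at c1 c2
    have hBq : B q = normalCoord (e.vec (φ.symm q)) (fderiv ℝ (s ∘ φ.symm) q Complex.I)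
      - Complex.I • normalCoord (e.vec (φ.symm q)) (fderiv ℝ (s ∘ φ.symm) q 1) := rfl
    refine ⟨?_, fun k hk => ?_⟩
    · rw [hBq, map_sub, map_smul]
      refine (congrArg₂ _ c1 (congrArg _ (cross_self _))).trans ?_
      simp
    · obtain ⟨k1, k2⟩ := hv₁ (e.mdiff_vec hqU k)
      have hz := e.normalDiff_vec_rot hγ hqU v₁ hk
      have c3 := c2 k hk
      simp only [normalDiff] at hz
      rw [hz, map_smul, LinearMap.smul_apply] at c3
      rw [← k1, ← k2] at hz
      rw [← k1] at c3
      refine ⟨hz, ?_⟩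
      rw [hBq, map_sub, map_smul]
      exact c3
  obtain ⟨q₀, r, hr, hball, P, hP, hmem⟩ := exists_flat_ball hΩ hne
    (fun i => (hê i).mono Set.inter_subset_left) (fun q hq => e.adapted _ hq.1.2)
    (hŝ.mono Set.inter_subset_left) (fun q hq k hk => ((hcr q hq).2 k hk).1) (fun _ => rfl)
    (fun q hq => hq.2) (fun q hq k hk => ((hcr q hq).2 k hk).2) (fun q hq => (hcr q hq).1)
  refine hflat (φ.source ∩ φ ⁻¹' Metric.ball q₀ r) ?_
    (φ.isOpen_inter_preimage Metric.isOpen_ball) ?_ ⟨P, hP, ?_⟩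
  · rintro p ⟨hp, hpb⟩
    have h1 : φ.symm (φ p) ∈ U := (hball hpb).1.2
    rwa [φ.left_inv hp] at h1
  · have h1 := Metric.mem_ball_self (x := q₀) hr
    have h2 := (hball h1).1.1
    exact ⟨φ.symm q₀, φ.map_target h2, by simpa [φ.right_inv h2] using hr⟩
  · rintro p ⟨hp, hpb⟩
    have h1 : φ.symm (φ p) ∈ U := (hball hpb).1.2
    obtain ⟨h2, h3⟩ := hmem _ hpb
    simp only [ê, φ.left_inv hp] at h1 h2 h3
    rw [← e.span p h1]
    exact plane_wedge_le h2 h3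

/-- The forms `θ` are of type `(1,0)`, so their conjugates are already of type `(0,1)`. This is why
the operator projects `κ` but not `[θ̄_od]`. -/
theorem piZeroOne_bracketThetaBar (hγ : IsPseudoholomorphic γ) (hp : p ∈ U) (i j : Fin 3) :
    piZeroOne (e.bracketThetaBar p i j) = e.bracketThetaBar p i j := by
  have hθ : ∀ v : Tan p, thetaVec (e.connMat p (rot p v))
      = Complex.I • thetaVec (e.connMat p v) := by
    intro v
    have h1 := e.normalDiff_vec_rot hγ hp v (k := 1) (by decide)
    have h2 := e.normalDiff_vec_rot hγ hp v (k := 2) (by decide)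
    change e.normalDiff (fun q => e.vec q 1) p (rot p v)
      + Complex.I • e.normalDiff (fun q => e.vec q 2) p (rot p v)
      = Complex.I • (e.normalDiff (fun q => e.vec q 1) p v
      + Complex.I • e.normalDiff (fun q => e.vec q 2) p v)
    rw [h1, h2, smul_add]
  have hb : ∀ v : Tan p, bracketMat (e.connMat p (rot p v)) i j
      = -Complex.I * bracketMat (e.connMat p v) i j := by
    intro v
    fin_cases i <;> fin_cases j <;> simp [bracketMat, hθ v]
  ext v
  simp only [piZeroOne, smul_apply, add_apply, ContinuousLinearMap.comp_apply, smul_eq_mul,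
    bracketThetaBar_apply, hb]
  linear_combination (-(1 / 2 : ℂ)) * bracketMat (e.connMat p v) i j * Complex.I_mul_I

theorem piZeroOne_add (b c : Tan p →L[ℝ] ℂ) :
    piZeroOne (b + c) = piZeroOne b + piZeroOne c := by
  ext v
  simp only [piZeroOne, smul_apply, add_apply, ContinuousLinearMap.comp_apply, smul_eq_mul]
  ring

theorem piZeroOne_smul (z : ℂ) (b : Tan p →L[ℝ] ℂ) : piZeroOne (z • b) = z • piZeroOne b := by
  ext v
  simp only [piZeroOne, smul_apply, add_apply, ContinuousLinearMap.comp_apply, smul_eq_mul]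
  ring

/-- The operator is the `(0,1)`-part of `α`. -/
theorem dbarOperator_apply (hγ : IsPseudoholomorphic γ) (s : sectionsH γ U) (p : U) (i : Fin 3) :
    e.dbarOperator s p i = piZeroOne (e.alpha s.1 i p) := by
  rw [e.alpha_eq s.2 p.2]
  simp only [Fin.sum_univ_three, piZeroOne_add, piZeroOne_smul,
    e.piZeroOne_bracketThetaBar hγ p.2]
  simp [dbarOperator, Fin.sum_univ_three]

end AdaptedFraming

end Surface

end

end Cayley

/-! ### The main theorem -/

theorem mainTheorem7 {S : Type*} [TopologicalSpace S] [ChartedSpace ℂ S] [IsManifold 𝓘(ℂ) ω S]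
    (γ : S → Cayley.Oct →L[ℝ] Cayley.Oct) (hγ : Cayley.IsPseudoholomorphic γ)
    (U : TopologicalSpace.Opens S) (e : Cayley.AdaptedFraming γ U)
    (hflat : ∀ V : Set S, V ⊆ U → IsOpen V → V.Nonempty → ¬ Cayley.IsFlatOn γ V) :
    (∀ s ∈ Cayley.sectionsH γ U,
      (∀ p ∈ U, ∀ i : Fin 3,
        e.alpha s i p = Cayley.diff (e.coef s i) p + ∑ j, e.coef s j p • e.kappa p i j
          + (Complex.I / 2) • ∑ j, (starRingEnd ℂ) (e.coef s j p) • e.bracketThetaBar p i j) ∧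
      (e.IsCayley s ↔ e.ReducedEquations s) ∧
      (e.IsCayley s ↔ ∀ p ∈ U, ∀ i : Fin 3, Cayley.IsOneZero (e.alpha s i p))) ∧
    {s : Cayley.sectionsH γ U | e.IsCayley s} = (LinearMap.ker e.dbarOperator : Set _) := by
  have hone : ∀ s ∈ Cayley.sectionsH γ U,
      (e.IsCayley s ↔ ∀ p ∈ U, ∀ i : Fin 3, Cayley.IsOneZero (e.alpha s i p)) := by
    intro s hs
    rw [e.isCayley_iff_crossEquations hγ hs]
    constructor
    · intro h p hp
      exact (e.isOneZero_alpha_iff hs hp).2 (e.rot_of_crossEquations hγ hflat hs h p hp)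
    · intro h
      exact e.crossEquations_of_rot hγ fun p hp => (e.isOneZero_alpha_iff hs hp).1 (h p hp)
  refine ⟨fun s hs => ⟨fun p hp i => e.alpha_eq hs hp i, ?_, hone s hs⟩, ?_⟩
  · rw [e.isCayley_iff_crossEquations hγ hs, e.reducedEquations_iff]
  · ext s
    rw [Set.mem_ofPred_eq, hone s.1 s.2, SetLike.mem_coe, LinearMap.mem_ker]
    constructor
    · intro h
      funext p i
      rw [e.dbarOperator_apply hγ]
      exact (Cayley.isOneZero_iff_piZeroOne _).1 (h p p.2 i)
    · intro h p hp i
      rw [Cayley.isOneZero_iff_piZeroOne, ← e.dbarOperator_apply hγ s ⟨p, hp⟩ i, h]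
      rfl
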